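/- **Setting.** Let $M\ge 2$, $S\in\mathbb N$, and let $\mathcal G$ be a connected undirected simple graph on the nodes $\{1,\dots,M\}$ with edge set $\mathcal E$ and degrees $d_i$. Let $f_1,\dots,f_M:\mathbb R^S\to\mathbb R$ be differentiable, let $L_i\ge 0$ be the smallest Lipschitz constant of $\nabla f_i$ (assumed to exist), put $f(x)=\frac1M\sum_i f_i(x_i)$ for $x=(x_1,\dots,x_M)\in(\mathbb R^S)^M$, and assume $\underline f:=\inf_x f(x)>-\infty$. Write $L=\mathrm{diag}(L_1,\dots,L_M)$, $d_0=(\nabla f_1(0),\dots,\nabla f_M(0))$, and $d_0^TL^{-1}d_0=\sum_i L_i^{-1}\|\nabla f_i(0)\|^2$ with $L^{-1}$ the pseudoinverse ($0^{-1}:=0$). Let $A\in\mathbb R^{\mathcal E\times M}$ be the incidence matrix: for an edge $e$ joining $i>j$, $A_{ei}=1/\sqrt{d_i}$, $A_{ej}=-1/\sqrt{d_j}$, other entries $0$. Let $P=\mathrm{diag}(d_i)$, $F=AP^{1/2}$, and $B=|F|$ entrywise. Given $\sigma_e>0$ ($e\in\mathcal E$) and $\beta_i>0$, let $\Sigma=\mathrm{diag}(\sigma_e)$,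 $\Upsilon=\mathrm{diag}(\beta_i)$, $\Delta=\mathrm{diag}\big(\sum_{e\ni i}\sigma_e^2\big)_i$, $H=B^T\Sigma^2B+\Upsilon^2$, $R=\Upsilon^{-2}F^T\Sigma^2F+I$. An $m\times n$ matrix acts on blocks in $\mathbb R^S$ as $(\cdot)\otimes I_S$; norms and inner products of stacked vectors are Euclidean. Let $\lambda_{\min},\lambda_{\max},\underline\lambda_{\min}$ be the smallest, largest and smallest nonzero eigenvalue, $\xi(\cdot)=\lambda_{\min}(\cdot)/\lambda_{\max}(\cdot)$, and $$\kappa=\frac1{\underline\lambda_{\min}(\Sigma FH^{-1}F^T\Sigma)},\qquad \widetilde\kappa=\frac1{\underline\lambda_{\min}(\Sigma F\Upsilon^{-2}F^T\Sigma)}.$$ For a sequence of iterates $x^r$ and an integer $T\ge1$ let $$e(T)=\min_{1\le r\le T}\Big(\Big\|\frac1M\sum_{i=1}^M\nabla f_i(x_i^r)\Big\|^2+\|\Sigma Fx^r\|^2\Big).$$ **(1) D-GPDA.** Let $x^0$ solve $\nabla f(0)+(2\Delta+\Upsilon^2)x^0=0$, let $\lambda^0=\Sigma^2Fx^0$, and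 for $r\ge0$ let $$x^{r+1}=\arg\min_x\ \langle\nabla f(x^r)+F^T\lambda^r,x-x^r\rangle+\tfrac12\|\Sigma Fx\|^2+\tfrac12\|\Sigma B(x-x^r)\|^2+\tfrac12\|\Upsilon(x-x^r)\|^2,\qquad \lambda^{r+1}=\lambda^r+\Sigma^2Fx^{r+1}.$$ Suppose that, with $c=\max\{6\kappa,1\}$, $$\Upsilon^2\succeq\frac{L\Upsilon^{-2}L}{M^2},\qquad \tfrac12(\Delta+\Upsilon^2)-\frac LM-\frac{4\kappa}{M^2}L\Upsilon^{-2}L-\frac{2cL}{M}\succeq0.$$ Then for every $T\ge1$, $$e(T)\le\frac{C_1C_2}{T},\qquad C_1=8\Big(f(x^0)-\underline f+\frac2Md_0^TL^{-1}d_0\Big),\quad C_2=4\sum_{e\in\mathcal E}\sigma_e^2+\sum_{i=1}^M\beta_i^2+4.$$ **(2) xFILTER.** Let $x^{-1}=0$, $d^{-1}=\tilde x^{-1}=-\Upsilon^{-2}\nabla f(0)$. For $r\ge-1$ set $u_0=x^r$, $u_1=(I-\tau R)u_0+\tau d^r$, $u_q=\alpha_q(I-\tau R)u_{q-1}+(1-\alpha_q)u_{q-2}+\tau\alpha_qd^r$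 for $2\le q\le Q$, and $$x^{r+1}=u_Q,\qquad \tilde x^{r+1}=x^{r+1}-\Upsilon^{-2}\nabla f(x^{r+1}),\qquad d^{r+1}=d^r+(\tilde x^{r+1}-\tilde x^r)-\Upsilon^{-2}F^T\Sigma^2Fx^{r+1},$$ where $\tau=\frac{2}{\lambda_{\min}(R)+\lambda_{\max}(R)}$, $\rho_0=\frac{1-\xi(R)}{1+\xi(R)}$, $\alpha_1=2$, $\alpha_{t+1}=\frac4{4-\rho_0^2\alpha_t}$. Suppose that, with $\tilde c=8\widetilde\kappa$, $$\Upsilon^2\succeq\frac{L\Upsilon^{-2}L}{M^2},\qquad \big(\tfrac14-3\widetilde\kappa-\tilde c\big)\Upsilon^2R-(1+2\tilde c)\frac LM-\frac{6\widetilde\kappa}{M^2}L\Upsilon^{-2}L\succeq0,$$ and that the integer $Q$ satisfies $$Q\ge-\frac14\ln\Big(\frac{\theta^2}{16+128M\max\{\lambda_{\max}(\Upsilon^2R),1\}}\Big)\sqrt{\frac1{\xi(R)}},\qquad \theta=\xi(\Upsilon^2R)\,\xi(\Upsilon^2)\min\{1,\lambda_{\min}(\Upsilon^2)\}.$$ Then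 for every number $T_r\ge1$ of outer iterations, $$e(T_r)\le\frac{\widetilde C_1\widetilde C_2}{T_r},\qquad \widetilde C_1=f(x^0)-\underline f+\frac5Md_0^TL^{-1}d_0,\quad \widetilde C_2=128\Big(\sum_{i=1}^M\beta_i^2+3+\frac1{32\widetilde\kappa}\Big).$$ -/

import Mathlib

noncomputable section

namespace DistOpt

/-! ### Problem data -/

/-- The space of one local variable, with its Euclidean norm. -/
abbrev Vec (S : ℕ) : Type := EuclideanSpace ℝ (Fin S)

/-- The average of the local functions, evaluated at separate local variables. -/
def objective {M S : ℕ} (f : Fin M → Vec S → ℝ) (x : Fin M → Vec S) : ℝ :=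
  (1 / (M : ℝ)) * ∑ i, f i (x i)

/-- The gradient of `objective f` at `x`; its block at node `i` is the gradient of `f i` at `x i`,
divided by the number of nodes. -/
def stackedGrad {M S : ℕ} (f : Fin M → Vec S → ℝ) (x : Fin M → Vec S) : Fin M → Vec S :=
  fun i => (1 / (M : ℝ)) • gradient (f i) (x i)

/-- The infimum of `objective f` over all stacked variables. -/
def objectiveInf {M S : ℕ} (f : Fin M → Vec S → ℝ) : ℝ :=
  ⨅ x : Fin M → Vec S, objective f x

/-- The problem class: differentiable local functions, `L i` is the smallest Lipschitz constant of
the gradient of `f i`, and the objective is bounded below. -/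
structure InProblemClass {M S : ℕ} (f : Fin M → Vec S → ℝ) (L : Fin M → ℝ) : Prop where
  differentiable : ∀ i, Differentiable ℝ (f i)
  lipschitz : ∀ i, IsLeast {K : ℝ | 0 ≤ K ∧ ∀ x z : Vec S,
    ‖gradient (f i) x - gradient (f i) z‖ ≤ K * ‖x - z‖} (L i)
  bddBelow : BddBelow (Set.range (objective f))

/-! ### Stacked vectors and matrices acting on them -/

/-- The action of `A ⊗ I` on a stacked vector. -/
def act {m n : Type} [Fintype n] {S : ℕ} (A : Matrix m n ℝ) (x : n → Vec S) : m → Vec S :=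
  fun k => ∑ j, A k j • x j

/-- The squared Euclidean norm of a stacked vector. -/
def sqNorm {n : Type} [Fintype n] {S : ℕ} (x : n → Vec S) : ℝ := ∑ j, ‖x j‖ ^ 2

/-- The Euclidean inner product of two stacked vectors. -/
def stackedInner {n : Type} [Fintype n] {S : ℕ} (x y : n → Vec S) : ℝ :=
  ∑ j, inner ℝ (x j) (y j)

/-! ### Eigenvalues -/

/-- The largest real eigenvalue. -/
def lamMax {n : Type} [Fintype n] [DecidableEq n] (A : Matrix n n ℝ) : ℝ := sSup (spectrum ℝ A)

/-- The smallest real eigenvalue. -/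
def lamMin {n : Type} [Fintype n] [DecidableEq n] (A : Matrix n n ℝ) : ℝ := sInf (spectrum ℝ A)

/-- The smallest nonzero real eigenvalue. -/
def lamMinNonzero {n : Type} [Fintype n] [DecidableEq n] (A : Matrix n n ℝ) : ℝ :=
  sInf (spectrum ℝ A \ {0})

/-- The ratio of the smallest to the largest eigenvalue. -/
def eigRatio {n : Type} [Fintype n] [DecidableEq n] (A : Matrix n n ℝ) : ℝ := lamMin A / lamMax A

/-! ### Graph matrices -/

section Graph

variable {M : ℕ} (G : SimpleGraph (Fin M)) [DecidableRel G.Adj]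

/-- The edges of the graph; every edge is listed once, as the pair `(i, j)` with `i > j`. -/
abbrev Edge : Type := {p : Fin M × Fin M // p.2 < p.1 ∧ G.Adj p.1 p.2}

/-- The (degree-normalized) incidence matrix. -/
def incidence : Matrix (Edge G) (Fin M) ℝ := fun e v =>
  if v = e.1.1 then 1 / √(G.degree v : ℝ)
  else if v = e.1.2 then -(1 / √(G.degree v : ℝ))
  else 0

/-- The scaled incidence matrix `F = A P^{1/2}`, where `P` is the degree matrix. -/
def scaledInc : Matrix (Edge G) (Fin M) ℝ :=
  incidence G * Matrix.diagonal (fun i => √(G.degree i : ℝ))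

/-- The entrywise absolute value `B = |F|`. -/
def absInc : Matrix (Edge G) (Fin M) ℝ := fun e v => |scaledInc G e v|

variable {G}

/-- The edge weights `σ` as a diagonal matrix. -/
def sigMat (σ : Edge G → ℝ) : Matrix (Edge G) (Edge G) ℝ := Matrix.diagonal σ

/-- The node weights `β` as a diagonal matrix. -/
def upsMat (β : Fin M → ℝ) : Matrix (Fin M) (Fin M) ℝ := Matrix.diagonal β

/-- The diagonal matrix whose `i`-th entry is the sum of `σ_e ^ 2` over the edges `e` at `i`. -/
def deltaMat (σ : Edge G → ℝ) : Matrix (Fin M) (Fin M) ℝ :=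
  Matrix.diagonal fun i => ∑ e : Edge G, if i = e.1.1 ∨ i = e.1.2 then σ e ^ 2 else 0

/-- `Fᵀ Σ² F`. -/
def weightedLap (σ : Edge G → ℝ) : Matrix (Fin M) (Fin M) ℝ :=
  (scaledInc G).transpose * sigMat σ ^ 2 * scaledInc G

/-- `H = Bᵀ Σ² B + Υ²`. -/
def hMat (σ : Edge G → ℝ) (β : Fin M → ℝ) : Matrix (Fin M) (Fin M) ℝ :=
  (absInc G).transpose * sigMat σ ^ 2 * absInc G + upsMat β ^ 2

/-- `R = Υ⁻² Fᵀ Σ² F + I`. -/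
def rMat (σ : Edge G → ℝ) (β : Fin M → ℝ) : Matrix (Fin M) (Fin M) ℝ :=
  (upsMat β ^ 2)⁻¹ * weightedLap σ + 1

/-- `κ = 1 / λ` for the smallest nonzero eigenvalue `λ` of `Σ F H⁻¹ Fᵀ Σ`. -/
def kappa (σ : Edge G → ℝ) (β : Fin M → ℝ) : ℝ :=
  1 / lamMinNonzero
    (sigMat σ * scaledInc G * (hMat σ β)⁻¹ * (scaledInc G).transpose * sigMat σ)

/-- `κ̃ = 1 / λ` for the smallest nonzero eigenvalue `λ` of `Σ F Υ⁻² Fᵀ Σ`. -/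
def kappaTilde (σ : Edge G → ℝ) (β : Fin M → ℝ) : ℝ :=
  1 / lamMinNonzero
    (sigMat σ * scaledInc G * (upsMat β ^ 2)⁻¹ * (scaledInc G).transpose * sigMat σ)

/-! ### Parameter conditions -/

/-- The parameter conditions for D-GPDA, with `c = max {6 κ, 1}`. -/
structure DGPDAParams (L : Fin M → ℝ) (σ : Edge G → ℝ) (β : Fin M → ℝ) : Prop where
  sigma_pos : ∀ e, 0 < σ e
  beta_pos : ∀ i, 0 < β i
  ups_large : (upsMat β ^ 2 - (1 / (M : ℝ) ^ 2) •
    (Matrix.diagonal L * (upsMat β ^ 2)⁻¹ * Matrix.diagonal L)).PosSemidef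
  main : ((1 / 2 : ℝ) • (deltaMat σ + upsMat β ^ 2) - (1 / (M : ℝ)) • Matrix.diagonal L
    - (4 * kappa σ β / (M : ℝ) ^ 2) •
        (Matrix.diagonal L * (upsMat β ^ 2)⁻¹ * Matrix.diagonal L)
    - (2 * max (6 * kappa σ β) 1 / (M : ℝ)) • Matrix.diagonal L).PosSemidef

/-- The parameter conditions for xFILTER, with `c̃ = 8 κ̃`. -/
structure XFilterParams (L : Fin M → ℝ) (σ : Edge G → ℝ) (β : Fin M → ℝ) : Prop where
  sigma_pos : ∀ e, 0 < σ e
  beta_pos : ∀ i, 0 < β i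
  ups_large : (upsMat β ^ 2 - (1 / (M : ℝ) ^ 2) •
    (Matrix.diagonal L * (upsMat β ^ 2)⁻¹ * Matrix.diagonal L)).PosSemidef
  main : ((1 / 4 - 3 * kappaTilde σ β - 8 * kappaTilde σ β) • (upsMat β ^ 2 * rMat σ β)
    - ((1 + 2 * (8 * kappaTilde σ β)) / (M : ℝ)) • Matrix.diagonal L
    - (6 * kappaTilde σ β / (M : ℝ) ^ 2) •
        (Matrix.diagonal L * (upsMat β ^ 2)⁻¹ * Matrix.diagonal L)).PosSemidef

/-! ### The algorithm D-GPDA -/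

variable {S : ℕ}

/-- The function of `y` that D-GPDA minimizes at the current primal and dual iterates. -/
def dgpdaModel (σ : Edge G → ℝ) (β : Fin M → ℝ) (f : Fin M → Vec S → ℝ)
    (x : Fin M → Vec S) (mu : Edge G → Vec S) (y : Fin M → Vec S) : ℝ :=
  stackedInner (stackedGrad f x + act (scaledInc G).transpose mu) (y - x)
    + (1 / 2) * sqNorm (act (sigMat σ * scaledInc G) y)
    + (1 / 2) * sqNorm (act (sigMat σ * absInc G) (y - x))
    + (1 / 2) * sqNorm (act (upsMat β) (y - x))

/-- `x` and `mu` are the primal and dual iterates (from iteration `0` on) of D-GPDA, started from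
zero primal and dual variables at iteration `-1`. -/
structure IsDGPDARun (σ : Edge G → ℝ) (β : Fin M → ℝ) (f : Fin M → Vec S → ℝ)
    (x : ℕ → Fin M → Vec S) (mu : ℕ → Edge G → Vec S) : Prop where
  init_x : stackedGrad f 0 + act ((2 : ℝ) • deltaMat σ + upsMat β ^ 2) (x 0) = 0
  init_mu : mu 0 = act (sigMat σ ^ 2 * scaledInc G) (x 0)
  step_x : ∀ r, IsMinOn (dgpdaModel σ β f (x r) (mu r)) Set.univ (x (r + 1))
  step_mu : ∀ r, mu (r + 1) = mu r + act (sigMat σ ^ 2 * scaledInc G) (x (r + 1))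

/-! ### The algorithm xFILTER -/

/-- The Chebyshev weights: `chebyWeight ρ k` is `α_{k+1}`. -/
def chebyWeight (ρ : ℝ) : ℕ → ℝ
  | 0 => 2
  | k + 1 => 4 / (4 - ρ ^ 2 * chebyWeight ρ k)

/-- The Chebyshev iteration for the linear system `R x = d` started at `u₀`, with step `τ` and
weights built from `ρ`. -/
def chebyIter (R : Matrix (Fin M) (Fin M) ℝ) (τ ρ : ℝ) (d u₀ : Fin M → Vec S) :
    ℕ → Fin M → Vec S
  | 0 => u₀
  | 1 => act (1 - τ • R) u₀ + τ • d
  | q + 2 => chebyWeight ρ (q + 1) • act (1 - τ • R) (chebyIter R τ ρ d u₀ (q + 1))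
      + (1 - chebyWeight ρ (q + 1)) • chebyIter R τ ρ d u₀ q
      + (τ * chebyWeight ρ (q + 1)) • d

/-- The Chebyshev step `τ = 2 / (λ_min(R) + λ_max(R))`. -/
def chebyStep (R : Matrix (Fin M) (Fin M) ℝ) : ℝ := 2 / (lamMin R + lamMax R)

/-- `ρ₀ = (1 - ξ(R)) / (1 + ξ(R))`. -/
def chebyRho (R : Matrix (Fin M) (Fin M) ℝ) : ℝ := (1 - eigRatio R) / (1 + eigRatio R)

/-- The variables of xFILTER after an outer iteration: the iterate `x`, the prediction `xt` and the
tracking variable `d`. -/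
structure XState (M S : ℕ) where
  x : Fin M → Vec S
  xt : Fin M → Vec S
  d : Fin M → Vec S

/-- `xfilterState σ β f Q k` are the variables of xFILTER with `Q` inner steps at outer iteration
`k - 1`; `k = 0` is the initialization at iteration `-1`. -/
def xfilterState (σ : Edge G → ℝ) (β : Fin M → ℝ) (f : Fin M → Vec S → ℝ) (Q : ℕ) :
    ℕ → XState M S
  | 0 =>
    { x := 0
      xt := 0 - act (upsMat β ^ 2)⁻¹ (stackedGrad f 0)
      d := -act (upsMat β ^ 2)⁻¹ (stackedGrad f 0) }
  | k + 1 =>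
    let s := xfilterState σ β f Q k
    let x' := chebyIter (rMat σ β) (chebyStep (rMat σ β)) (chebyRho (rMat σ β)) s.d s.x Q
    let xt' := x' - act (upsMat β ^ 2)⁻¹ (stackedGrad f x')
    { x := x'
      xt := xt'
      d := s.d + (xt' - s.xt) - act ((upsMat β ^ 2)⁻¹ * weightedLap σ) x' }

/-- The xFILTER iterate at outer iteration `r ≥ 0`. -/
def xfilterIter (σ : Edge G → ℝ) (β : Fin M → ℝ) (f : Fin M → Vec S → ℝ) (Q : ℕ) (r : ℕ) :
    Fin M → Vec S :=
  (xfilterState σ β f Q (r + 1)).x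

/-- `θ = ξ(Υ² R) ξ(Υ²) min {1, λ_min(Υ²)}`. -/
def thetaConst (σ : Edge G → ℝ) (β : Fin M → ℝ) : ℝ :=
  eigRatio (upsMat β ^ 2 * rMat σ β) * eigRatio (upsMat β ^ 2) * min 1 (lamMin (upsMat β ^ 2))

/-- The prescribed (real) number of Chebyshev steps per outer iteration. -/
def innerSteps (σ : Edge G → ℝ) (β : Fin M → ℝ) : ℝ :=
  -(1 / 4) * Real.log (thetaConst σ β ^ 2 /
      (16 + 128 * (M : ℝ) * max (lamMax (upsMat β ^ 2 * rMat σ β)) 1))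
    * √(1 / eigRatio (rMat σ β))

/-! ### Error measure and constants -/

/-- The stationarity and consensus error `‖(1/M) ∑ ∇ f_i(x_i)‖² + ‖Σ F x‖²`. -/
def gap (σ : Edge G → ℝ) (f : Fin M → Vec S → ℝ) (x : Fin M → Vec S) : ℝ :=
  ‖(1 / (M : ℝ)) • ∑ i, gradient (f i) (x i)‖ ^ 2 + sqNorm (act (sigMat σ * scaledInc G) x)

/-- `d₀ᵀ L⁻¹ d₀` with `d₀ = [∇ f_1(0), …, ∇ f_M(0)]` and the pseudoinverse of `L` (the inverse of
the real number `0` is `0`). -/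
def initEnergy (f : Fin M → Vec S → ℝ) (L : Fin M → ℝ) : ℝ :=
  ∑ i, (L i)⁻¹ * ‖gradient (f i) 0‖ ^ 2

end Graph

end DistOpt

end

/-! Both algorithms are instances of one inexact primal-dual scheme. The dual variable (for xFILTER,
the tracking variable) telescopes: it is determined by the sum X of the iterates so far. With A =
FᵀΣ²F, an iteration then reads ∇f(x_k) + A X_{k+1} + K(x_{k+1} - x_k) = (A + K)ζ_{k+1}. For D-GPDA,
K = H and ζ = 0; for xFILTER, K = Υ² and ζ is the error left by the Chebyshev solver.
`PrimalDualRun` records this scheme, with index 0 standing for iteration -1.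

The augmented Lagrangian alone does not decrease: each dual ascent adds A(x_{k+2}, x_{k+2}).
Subtracting two consecutive optimality conditions expresses A x_{k+2} through a gradient difference,
a second difference of the iterates and residuals; testing with its K-representative
(`exists_riesz`) bounds the violation by κ or κ̃ times these terms. The second difference is paid
for by c times the same subtracted conditions, now tested with the primal step. The resulting
`potential` drops at every iteration by a multiple of the squared step plus a multiple of the
violation (`potential_succ_le`).

The potential is bounded below although its coupling term A(X, x) has no sign: the partial sums of
that term are nonnegative, and a decreasing sequence whose partial sums above a level are
nonnegative never falls below that level. Summing the drops therefore bounds the total of squared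
steps and violations (`sum_le`). Block-constant vectors lie in the kernel of A, so testing
optimality with them bounds the averaged gradient by the step (`grad_sq_le`). The initial potential
is handled by `first_le`, and `inf_gap_le` turns the sum into the 1/T rate.

For xFILTER there remains to show that Q inner steps make ζ small relative to the step. The
Chebyshev error is explicit in an eigenbasis (`act_chebyIter_sub`), which gives the contraction
`form_chebyIter_sub_le` and the accuracy `cheby_accuracy`. -/

noncomputable section

namespace DistOpt

/-! ### Linear algebra of stacked vectors and the bilinear forms of matrices. -/

section Stacked

variable {l m n : Type} [Fintype n] {S : ℕ}

theorem act_add (A : Matrix m n ℝ) (x y : n → Vec S) : act A (x + y) = act A x + act A y := by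
  funext k; simp [act, Finset.sum_add_distrib]

theorem act_smul (A : Matrix m n ℝ) (c : ℝ) (x : n → Vec S) : act A (c • x) = c • act A x := by
  funext k; simp [act, Finset.smul_sum, smul_comm c]

theorem act_neg (A : Matrix m n ℝ) (x : n → Vec S) : act A (-x) = -act A x := by
  simpa using act_smul A (-1) x

theorem act_sub (A : Matrix m n ℝ) (x y : n → Vec S) : act A (x - y) = act A x - act A y := by
  rw [sub_eq_add_neg, act_add, act_neg, sub_eq_add_neg]

theorem act_zero (A : Matrix m n ℝ) : act A (0 : n → Vec S) = 0 := by
  simpa using act_smul A 0 (0 : n → Vec S)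

theorem add_act (A B : Matrix m n ℝ) (x : n → Vec S) : act (A + B) x = act A x + act B x := by
  funext k; simp [act, add_smul, Finset.sum_add_distrib]

theorem smul_act (c : ℝ) (A : Matrix m n ℝ) (x : n → Vec S) : act (c • A) x = c • act A x := by
  funext k; simp [act, Finset.smul_sum, mul_smul]

theorem sub_act (A B : Matrix m n ℝ) (x : n → Vec S) : act (A - B) x = act A x - act B x := by
  funext k; simp [act, sub_smul, Finset.sum_sub_distrib]

variable [Fintype m]

theorem mul_act (A : Matrix l m ℝ) (B : Matrix m n ℝ) (x : n → Vec S) :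
    act (A * B) x = act A (act B x) := by
  funext k
  simp only [act, Matrix.mul_apply, Finset.sum_smul, Finset.smul_sum, mul_smul]
  exact Finset.sum_comm

theorem diagonal_act [DecidableEq n] (d : n → ℝ) (x : n → Vec S) (i : n) :
    act (Matrix.diagonal d) x i = d i • x i := by
  simp [act, Matrix.diagonal_apply, ite_smul]

theorem one_act [DecidableEq n] (x : n → Vec S) : act (1 : Matrix n n ℝ) x = x := by
  funext i
  rw [← Matrix.diagonal_one, diagonal_act, one_smul]

theorem stackedInner_comm (x y : n → Vec S) : stackedInner x y = stackedInner y x := by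
  simp [stackedInner, real_inner_comm]

theorem stackedInner_add (x y z : n → Vec S) :
    stackedInner x (y + z) = stackedInner x y + stackedInner x z := by
  simp [stackedInner, inner_add_right, Finset.sum_add_distrib]

theorem stackedInner_smul (c : ℝ) (x y : n → Vec S) :
    stackedInner x (c • y) = c * stackedInner x y := by
  simp [stackedInner, inner_smul_right, Finset.mul_sum]

theorem stackedInner_act (A : Matrix m n ℝ) (x : n → Vec S) (y : m → Vec S) :
    stackedInner (act A x) y = stackedInner x (act A.transpose y) := by
  simp only [stackedInner, act, sum_inner, inner_sum, Matrix.transpose_apply, inner_smul_left,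
    inner_smul_right]
  exact Finset.sum_comm

theorem sqNorm_eq_stackedInner (x : n → Vec S) : sqNorm x = stackedInner x x := by
  simp [sqNorm, stackedInner]

theorem sqNorm_nonneg (x : n → Vec S) : 0 ≤ sqNorm x :=
  Finset.sum_nonneg fun _ _ => by positivity

/-- The inner product with a fixed stacked vector, as a linear functional. -/
def innerForm (x : n → Vec S) : (n → Vec S) →ₗ[ℝ] ℝ where
  toFun := stackedInner x
  map_add' := stackedInner_add x
  map_smul' c y := by simp [stackedInner_smul]

@[simp] theorem innerForm_apply (x y : n → Vec S) : innerForm x y = stackedInner x y := rfl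

/-- The bilinear form `(x, y) ↦ ⟨P x, y⟩` on stacked vectors. -/
def form (P : Matrix n n ℝ) : LinearMap.BilinForm ℝ (n → Vec S) :=
  LinearMap.mk₂ ℝ (fun x y => stackedInner (act P x) y)
    (fun x x' y => by rw [act_add, stackedInner_comm, stackedInner_add, stackedInner_comm y,
      stackedInner_comm y])
    (fun c x y => by rw [act_smul, stackedInner_comm, stackedInner_smul, stackedInner_comm y]; rfl)
    (fun x y y' => stackedInner_add _ _ _)
    (fun c x y => by rw [stackedInner_smul]; rfl)

theorem form_apply (P : Matrix n n ℝ) (x y : n → Vec S) :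
    form P x y = stackedInner (act P x) y := rfl

theorem form_add (P Q : Matrix n n ℝ) (x y : n → Vec S) :
    form (P + Q) x y = form P x y + form Q x y := by
  rw [form_apply, add_act, stackedInner_comm, stackedInner_add, stackedInner_comm y,
    stackedInner_comm y, form_apply, form_apply]

theorem form_smul (c : ℝ) (P : Matrix n n ℝ) (x y : n → Vec S) :
    form (c • P) x y = c * form P x y := by
  rw [form_apply, smul_act, stackedInner_comm, stackedInner_smul, stackedInner_comm y, form_apply]

theorem form_sub (P Q : Matrix n n ℝ) (x y : n → Vec S) :
    form (P - Q) x y = form P x y - form Q x y := by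
  rw [eq_sub_iff_add_eq, ← form_add, sub_add_cancel]

theorem form_comm {P : Matrix n n ℝ} (hP : P.IsHermitian) (x y : n → Vec S) :
    form P x y = form P y x := by
  have h : P.transpose = P := by simpa [Matrix.IsHermitian] using hP
  rw [form_apply, stackedInner_act, h, stackedInner_comm, form_apply]

theorem form_transpose_mul (B : Matrix m n ℝ) (P : Matrix m m ℝ) (x y : n → Vec S) :
    form (B.transpose * P * B) x y = form P (act B x) (act B y) := by
  rw [form_apply, mul_act, mul_act, stackedInner_act, Matrix.transpose_transpose, form_apply]

theorem form_one [DecidableEq n] (x y : n → Vec S) :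
    form (1 : Matrix n n ℝ) x y = stackedInner x y := by
  rw [form_apply, one_act]

theorem form_transpose_mul_self (B : Matrix m n ℝ) (x y : n → Vec S) :
    form (B.transpose * B) x y = stackedInner (act B x) (act B y) := by
  rw [form_apply, mul_act, stackedInner_act, Matrix.transpose_transpose]

theorem sqNorm_act (B : Matrix m n ℝ) (x : n → Vec S) :
    sqNorm (act B x) = form (B.transpose * B) x x := by
  rw [form_transpose_mul_self, sqNorm_eq_stackedInner]

theorem form_diagonal [DecidableEq n] (d : n → ℝ) (x y : n → Vec S) :
    form (Matrix.diagonal d) x y = ∑ i, d i * inner ℝ (x i) (y i) := by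
  simp [form_apply, stackedInner, diagonal_act, inner_smul_left]

theorem form_diagonal_self [DecidableEq n] (d : n → ℝ) (x : n → Vec S) :
    form (Matrix.diagonal d) x x = ∑ i, d i * ‖x i‖ ^ 2 := by
  simp [form_diagonal]

theorem form_eq_sum_dotProduct (P : Matrix n n ℝ) (x y : n → Vec S) :
    form P x y = ∑ s, (fun i => y i s) ⬝ᵥ (P.mulVec fun i => x i s) := by
  simp only [form_apply, stackedInner, act, PiLp.inner_apply, dotProduct, Matrix.mulVec]
  rw [Finset.sum_comm]
  refine Finset.sum_congr rfl fun s _ => Finset.sum_congr rfl fun i _ => ?_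
  simp

theorem form_nonneg {P : Matrix n n ℝ} (hP : P.PosSemidef) (x : n → Vec S) : 0 ≤ form P x x := by
  rw [form_eq_sum_dotProduct]
  refine Finset.sum_nonneg fun s _ => ?_
  simpa using hP.dotProduct_mulVec_nonneg (fun i => x i s)

end Stacked

/-! ### Eigenvalue bounds and the smallest nonzero eigenvalue. -/

section Spectral

variable {m n : Type} [Fintype m] [Fintype n] [DecidableEq n] {S : ℕ}

/-- Orthogonal diagonalization of a real symmetric matrix. -/
theorem exists_diagonalization {P : Matrix n n ℝ} (hP : P.IsHermitian) :
    ∃ (U : Matrix n n ℝ) (d : n → ℝ), U.transpose * U = 1 ∧ U * U.transpose = 1 ∧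
      P = U.transpose * Matrix.diagonal d * U ∧ spectrum ℝ P = Set.range d := by
  have h1 := (Matrix.mem_unitaryGroup_iff (A := (hP.eigenvectorUnitary : Matrix n n ℝ))).1
    hP.eigenvectorUnitary.2
  have h2 := (Matrix.mem_unitaryGroup_iff' (A := (hP.eigenvectorUnitary : Matrix n n ℝ))).1
    hP.eigenvectorUnitary.2
  have h3 := hP.spectral_theorem
  refine ⟨(hP.eigenvectorUnitary : Matrix n n ℝ).transpose, hP.eigenvalues, ?_, ?_, ?_,
    hP.spectrum_real_eq_range_eigenvalues⟩
  · simpa [Matrix.star_eq_conjTranspose] using h1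
  · simpa [Matrix.star_eq_conjTranspose] using h2
  · rw [Unitary.conjStarAlgAut_apply] at h3
    simpa [Matrix.star_eq_conjTranspose, Function.comp_def] using h3

theorem form_le_lamMax {P : Matrix n n ℝ} (hP : P.IsHermitian) (x : n → Vec S) :
    form P x x ≤ lamMax P * sqNorm x := by
  obtain ⟨U, d, hU, -, hd, hs⟩ := exists_diagonalization hP
  have h1 : sqNorm x = ∑ j, ‖act U x j‖ ^ 2 := by
    change _ = sqNorm (act U x)
    rw [sqNorm_act, hU, form_one, sqNorm_eq_stackedInner]
  conv_lhs => rw [hd]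
  rw [form_transpose_mul, form_diagonal_self, h1, Finset.mul_sum]
  refine Finset.sum_le_sum fun j _ => mul_le_mul_of_nonneg_right ?_ (by positivity)
  rw [lamMax, hs]
  exact le_csSup (Set.finite_range d).bddAbove ⟨j, rfl⟩

theorem lamMin_le_form {P : Matrix n n ℝ} (hP : P.IsHermitian) (x : n → Vec S) :
    lamMin P * sqNorm x ≤ form P x x := by
  obtain ⟨U, d, hU, -, hd, hs⟩ := exists_diagonalization hP
  have h1 : sqNorm x = ∑ j, ‖act U x j‖ ^ 2 := by
    change _ = sqNorm (act U x)
    rw [sqNorm_act, hU, form_one, sqNorm_eq_stackedInner]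
  conv_rhs => rw [hd]
  rw [form_transpose_mul, form_diagonal_self, h1, Finset.mul_sum]
  refine Finset.sum_le_sum fun j _ => mul_le_mul_of_nonneg_right ?_ (by positivity)
  rw [lamMin, hs]
  exact csInf_le (Set.finite_range d).bddBelow ⟨j, rfl⟩

theorem lamMin_pos [Nonempty n] {P : Matrix n n ℝ} {d : n → ℝ} (hs : spectrum ℝ P = Set.range d)
    (hd : ∀ j, 0 < d j) : 0 < lamMin P := by
  rw [lamMin, hs]
  obtain ⟨j, hj⟩ := (Set.range_nonempty d).csInf_mem (Set.finite_range d)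
  rw [← hj]; exact hd j

theorem lamMin_le_lamMax [Nonempty n] {P : Matrix n n ℝ} {d : n → ℝ}
    (hs : spectrum ℝ P = Set.range d) : lamMin P ≤ lamMax P := by
  rw [lamMin, lamMax, hs]
  exact csInf_le_csSup (Set.range_nonempty d) (Set.finite_range d).bddBelow (Set.finite_range d).bddAbove

theorem eigRatio_mem_Ioc [Nonempty n] {P : Matrix n n ℝ} {d : n → ℝ}
    (hs : spectrum ℝ P = Set.range d) (hd : ∀ j, 0 < d j) : eigRatio P ∈ Set.Ioc 0 1 := by
  have h1 := lamMin_pos hs hd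
  have h2 := lamMin_le_lamMax hs
  exact ⟨div_pos h1 (h1.trans_le h2), (div_le_one (h1.trans_le h2)).2 h2⟩

theorem spectrum_eq_range_of_posDef {P : Matrix n n ℝ} (hP : P.PosDef) :
    ∃ d : n → ℝ, spectrum ℝ P = Set.range d ∧ ∀ j, 0 < d j :=
  ⟨_, hP.1.spectrum_real_eq_range_eigenvalues, hP.eigenvalues_pos⟩

theorem lamMinNonzero_nonneg {N : Matrix n n ℝ} (hN : N.PosSemidef) : 0 ≤ lamMinNonzero N := by
  refine Real.sInf_nonneg fun t ht => ?_
  rw [hN.1.spectrum_real_eq_range_eigenvalues] at ht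
  obtain ⟨⟨j, rfl⟩, -⟩ := ht
  exact hN.eigenvalues_nonneg j

theorem posSemidef_mul_inv_mul_transpose (B : Matrix m n ℝ) {K : Matrix n n ℝ} (hK : K.PosDef) :
    (B * K⁻¹ * B.transpose).PosSemidef := by
  simpa using hK.inv.posSemidef.mul_mul_conjTranspose_same B

variable [DecidableEq m]

/-- The smallest nonzero eigenvalue of `B K⁻¹ Bᵀ` controls that matrix from below on the range of
`B`. -/
theorem sqNorm_act_le (B : Matrix m n ℝ) {K : Matrix n n ℝ} (hK : K.PosDef) (x : n → Vec S) :
    sqNorm (act B x) ≤ 1 / lamMinNonzero (B * K⁻¹ * B.transpose) *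
      form (B * K⁻¹ * B.transpose) (act B x) (act B x) := by
  have hN := posSemidef_mul_inv_mul_transpose B hK
  obtain ⟨U, d, hU, hU', hd, hs⟩ := exists_diagonalization hN.1
  set N := B * K⁻¹ * B.transpose with hNdef
  have h1 : sqNorm (act B x) = ∑ j, ‖act U (act B x) j‖ ^ 2 := by
    change _ = sqNorm (act U (act B x))
    rw [sqNorm_act U, hU, form_one, sqNorm_eq_stackedInner]
  have hdiag : Matrix.diagonal d = (U * B) * K⁻¹ * (U * B).transpose := by
    have : U * N * U.transpose = Matrix.diagonal d := by
      rw [hd]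
      calc U * (U.transpose * Matrix.diagonal d * U) * U.transpose
          = (U * U.transpose) * Matrix.diagonal d * (U * U.transpose) := by
            simp only [Matrix.mul_assoc]
        _ = _ := by rw [hU']; simp
    rw [← this, hNdef, Matrix.transpose_mul]
    simp only [Matrix.mul_assoc]
  have hentry : ∀ j, d j = (U * B) j ⬝ᵥ (K⁻¹.mulVec ((U * B) j)) := by
    intro j
    have := congrFun (congrFun hdiag j) j
    rw [Matrix.diagonal_apply_eq] at this
    rw [this, Matrix.mul_assoc]
    simp only [Matrix.mul_apply, dotProduct, Matrix.mulVec, Matrix.transpose_apply]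
  have hnn : ∀ j, 0 ≤ d j := fun j => by
    rw [hentry]; simpa using hK.inv.posSemidef.dotProduct_mulVec_nonneg ((U * B) j)
  have hform : form N (act B x) (act B x) = ∑ j, d j * ‖act U (act B x) j‖ ^ 2 := by
    rw [hd, form_transpose_mul, form_diagonal_self]
  rw [hform, h1, Finset.mul_sum]
  refine Finset.sum_le_sum fun j _ => ?_
  by_cases hj : d j = 0
  -- By definiteness of K⁻¹, a null eigenvector of B K⁻¹ Bᵀ is orthogonal to the range of B, so this
  -- component of B x vanishes. If every eigenvalue is zero, only this branch occurs, and the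
  -- constant 1 / sInf ∅ = 0 does no harm.
  · have hrow : (U * B) j = 0 := by
      by_contra hne
      have := hK.inv.dotProduct_mulVec_pos hne
      rw [star_trivial, ← hentry j, hj] at this
      exact lt_irrefl _ this
    have : act U (act B x) j = 0 := by
      rw [← mul_act]
      simp [act, hrow]
    simp [this]
  · have hmem : d j ∈ spectrum ℝ N \ {0} := ⟨hs ▸ ⟨j, rfl⟩, hj⟩
    have hfin : (spectrum ℝ N \ {0}).Finite := (hs ▸ Set.finite_range d).subset Set.sdiff_subset
    have hle : lamMinNonzero N ≤ d j := csInf_le hfin.bddBelow hmem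
    have hmin : lamMinNonzero N ∈ spectrum ℝ N \ {0} := Set.Nonempty.csInf_mem ⟨_, hmem⟩ hfin
    have hpos : 0 < lamMinNonzero N :=
      lt_of_le_of_ne (lamMinNonzero_nonneg hN) (Ne.symm hmin.2)
    rw [← mul_assoc]
    refine le_mul_of_one_le_left (by positivity) ?_
    rw [one_div, inv_mul_eq_div]
    exact (one_le_div hpos).2 hle

/-- The Riesz representative `z` of `⟨B x, B ·⟩` in the inner product of `K`. -/
theorem exists_riesz (B : Matrix m n ℝ) {K : Matrix n n ℝ} (hK : K.PosDef) (x : n → Vec S) :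
    ∃ z : n → Vec S, (∀ v, form (B.transpose * B) x v = form K z v) ∧
      form (B.transpose * B) x x ≤
        1 / lamMinNonzero (B * K⁻¹ * B.transpose) * form K z z := by
  have hKi : K * K⁻¹ = 1 := Matrix.mul_nonsing_inv K ((Matrix.isUnit_iff_isUnit_det K).1 hK.isUnit)
  have hz : ∀ v, form (B.transpose * B) x v =
      form K (act K⁻¹ (act (B.transpose * B) x)) v := by
    intro v
    rw [form_apply, form_apply, ← mul_act, hKi, one_act]
  refine ⟨act K⁻¹ (act (B.transpose * B) x), hz, ?_⟩
  rw [← hz, ← sqNorm_act]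
  convert sqNorm_act_le B hK x using 2
  rw [form_apply, form_apply, mul_act, mul_act, mul_act, stackedInner_act B (act K⁻¹ _),
    stackedInner_comm]

end Spectral

/-! ### The abstract primal-dual run: potential, descent and summability. -/

section Potential

variable {E : Type*} [AddCommGroup E] [Module ℝ E]

theorem bilin_self_sub {A : LinearMap.BilinForm ℝ E} (hA : ∀ u v, A u v = A v u) (u v : E) :
    A u (u - v) = (A u u - A v v + A (u - v) (u - v)) / 2 := by
  simp only [map_sub, LinearMap.sub_apply, hA v u]
  ring

theorem bilin_sub_self_le {A : LinearMap.BilinForm ℝ E} (h0 : ∀ u, 0 ≤ A u u) (u v : E) :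
    A (u - v) (u - v) ≤ 2 * A u u + 2 * A v v := by
  have h := h0 (u + v)
  simp only [map_add, map_sub, LinearMap.add_apply, LinearMap.sub_apply] at h ⊢
  linarith

/-- Young's inequality for a positive semidefinite form. -/
theorem bilin_le_young {A : LinearMap.BilinForm ℝ E} (hA : ∀ u v, A u v = A v u)
    (h0 : ∀ u, 0 ≤ A u u) {t : ℝ} (ht : 0 < t) (u v : E) :
    A u v ≤ t / 2 * A u u + 1 / (2 * t) * A v v := by
  have h := h0 (t • u - v)
  simp only [map_sub, map_smul, LinearMap.sub_apply, LinearMap.smul_apply, smul_eq_mul, hA v u] at h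
  rw [show t / 2 * A u u + 1 / (2 * t) * A v v = (t ^ 2 * A u u + A v v) / (2 * t) by
    field_simp, le_div_iff₀ (by positivity)]
  linarith

theorem bilin_sq_le {A : LinearMap.BilinForm ℝ E} (hA : ∀ u v, A u v = A v u)
    (h0 : ∀ u, 0 ≤ A u u) (u v : E) : A u v ^ 2 ≤ A u u * A v v :=
  LinearMap.BilinForm.apply_sq_le_of_symm A h0 ⟨hA⟩ u v

/-- Cauchy–Schwarz for a possibly degenerate form, followed by the arithmetic-geometric mean
inequality. It makes residual terms quadratic in the steps. -/
theorem bilin_le_of_self_le {A : LinearMap.BilinForm ℝ E} (hA : ∀ u v, A u v = A v u)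
    (h0 : ∀ u, 0 ≤ A u u) {η : ℝ} (hη : 0 ≤ η) {z w : E} (h : A z z ≤ η ^ 2 * A w w) (v : E) :
    A z v ≤ η / 2 * (A w w + A v v) := by
  have h1 := bilin_sq_le hA h0 z v
  have h2 : A z z * A v v ≤ η ^ 2 * A w w * A v v := mul_le_mul_of_nonneg_right h (h0 v)
  refine abs_le_of_sq_le_sq' (b := η / 2 * (A w w + A v v)) ?_ ?_ |>.2
  · nlinarith [mul_nonneg (sq_nonneg η) (sq_nonneg (A w w - A v v))]
  · exact mul_nonneg (by linarith) (add_nonneg (h0 w) (h0 v))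

/-- An inexact primal-dual run for the quadratic coupling `A` and the proximal term `K`, after
elimination of the dual variable: `X k` is the sum of the iterates up to `k`, the functional `g k`
is the derivative of the objective at `x k`, and `ζ k` measures the inexactness of step `k`. -/
structure PrimalDualRun (A K : LinearMap.BilinForm ℝ E) (ℓ q : E → ℝ) (a b c s η : ℝ)
    (x X ζ : ℕ → E) (g : ℕ → E →ₗ[ℝ] ℝ) (φ : ℕ → ℝ) (φmin : ℝ) : Prop where
  A_symm : ∀ u v, A u v = A v u
  K_symm : ∀ u v, K u v = K v u
  A_nonneg : ∀ u, 0 ≤ A u u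
  K_nonneg : ∀ u, 0 ≤ K u u
  ℓ_nonneg : ∀ u, 0 ≤ ℓ u
  q_nonneg : ∀ u, 0 ≤ q u
  a_nonneg : 0 ≤ a
  c_nonneg : 0 ≤ c
  s_nonneg : 0 ≤ s
  η_nonneg : 0 ≤ η
  x_zero : x 0 = 0
  X_zero : X 0 = 0
  X_succ : ∀ k, X (k + 1) = X k + x (k + 1)
  opt : ∀ k v, g k v + A (X (k + 1)) v + K (x (k + 1) - x k) v = (A + K) (ζ (k + 1)) v
  residual : ∀ k, (A + K) (ζ (k + 1)) (ζ (k + 1)) ≤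
    η ^ 2 * (A + K) (x (k + 1) - x k) (x (k + 1) - x k)
  descent : ∀ k, φ (k + 1) ≤ φ k + g k (x (k + 1) - x k) + ℓ (x (k + 1) - x k) / 2
  grad_diff : ∀ k v, |g (k + 1) v - g k v| ≤ ℓ (x (k + 1) - x k) / 2 + ℓ v / 2
  dual : ∀ k, A (x (k + 2)) (x (k + 2)) ≤ a * q (x (k + 1) - x k)
    + b * K ((x (k + 2) - x (k + 1)) - (x (k + 1) - x k))
        ((x (k + 2) - x (k + 1)) - (x (k + 1) - x k))
    + s * ((A + K) (x (k + 2) - x (k + 1)) (x (k + 2) - x (k + 1))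
      + (A + K) (x (k + 1) - x k) (x (k + 1) - x k))
  lower : ∀ k, φmin ≤ φ k
  coef_b : 4 / 3 * b ≤ c / 2
  coef : ∀ v, (1 / 2 + c) * ℓ v + 4 / 3 * a * q v + (η + 2 * η * c + 8 / 3 * s) * (A + K) v v ≤
    3 / 8 * (A + K) v v

namespace PrimalDualRun

variable {A K : LinearMap.BilinForm ℝ E} {ℓ q : E → ℝ} {a b c s η : ℝ}
  {x X ζ : ℕ → E} {g : ℕ → E →ₗ[ℝ] ℝ} {φ : ℕ → ℝ} {φmin : ℝ}

theorem sum_symm (h : PrimalDualRun A K ℓ q a b c s η x X ζ g φ φmin) (u v : E) :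
    (A + K) u v = (A + K) v u := by
  simp only [LinearMap.add_apply, h.A_symm u v, h.K_symm u v]

theorem sum_nonneg (h : PrimalDualRun A K ℓ q a b c s η x X ζ g φ φmin) (u : E) :
    0 ≤ (A + K) u u := add_nonneg (h.A_nonneg u) (h.K_nonneg u)

/-- The potential: the augmented Lagrangian plus a multiple of the constraint violation and of the
proximal terms. -/
def potential (A K : LinearMap.BilinForm ℝ E) (ℓ q : E → ℝ) (a c s η : ℝ) (x X : ℕ → E)
    (φ : ℕ → ℝ) (k : ℕ) : ℝ :=
  φ (k + 1) + A (X (k + 1)) (x (k + 1)) + A (x (k + 1)) (x (k + 1)) / 2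
    + c / 2 * (A (x (k + 1)) (x (k + 1)) + K (x (k + 1) - x k) (x (k + 1) - x k)
      + ℓ (x (k + 1) - x k) + η * (A + K) (x (k + 1) - x k) (x (k + 1) - x k))
    + 4 / 3 * (a * q (x (k + 1) - x k) + s * (A + K) (x (k + 1) - x k) (x (k + 1) - x k))

/-- The bound `e1` on the augmented Lagrangian, c times `e2` and 4/3 of the dual bound are added.
The factor 4/3 turns the increase A(x_{k+2}, x_{k+2}) into a decrease with coefficient 1/3; `coef_b`
lets the term -c/2 K(u' - u, u' - u) absorb the second difference; `coef` spends 3/8 of the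
available 1/2 (A + K)(u', u'), leaving 1/8. -/
theorem potential_succ_le (h : PrimalDualRun A K ℓ q a b c s η x X ζ g φ φmin) (k : ℕ) :
    potential A K ℓ q a c s η x X φ (k + 1) ≤ potential A K ℓ q a c s η x X φ k
      - (1 / 8 * (A + K) (x (k + 2) - x (k + 1)) (x (k + 2) - x (k + 1))
        + 1 / 3 * A (x (k + 2)) (x (k + 2))) := by
  simp only [potential, show k + 1 + 1 = k + 2 from rfl]
  set u := x (k + 1) - x k with hu
  set u' := x (k + 2) - x (k + 1) with hu'
  have ho1 := h.opt (k + 1) u'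
  have ho0 := h.opt k u'
  simp only [show k + 1 + 1 = k + 2 from rfl] at ho1
  rw [← hu'] at ho1
  rw [← hu] at ho0
  have hX : X (k + 2) = X (k + 1) + x (k + 2) := h.X_succ (k + 1)
  have hAX : A (X (k + 2)) u' = A (X (k + 1)) u' + A (x (k + 2)) u' := by
    rw [hX, map_add, LinearMap.add_apply]
  have hAX2 : A (X (k + 2)) (x (k + 2)) = A (X (k + 2)) u' + A (X (k + 1)) (x (k + 1))
      + A (x (k + 2)) (x (k + 1)) := by
    rw [hX, hu']
    simp only [map_sub, map_add, LinearMap.add_apply]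
    ring
  have hp1 : A (x (k + 2)) u' = _ := bilin_self_sub h.A_symm (x (k + 2)) (x (k + 1))
  rw [← hu'] at hp1
  have hp2 : A (x (k + 2)) u' = A (x (k + 2)) (x (k + 2)) - A (x (k + 2)) (x (k + 1)) := by
    rw [hu', map_sub]
  have hp3 := bilin_self_sub h.K_symm u' u
  have hp4 : K u' (u' - u) = K u' u' - K u u' := by rw [map_sub, h.K_symm u' u]
  have hz1 : (A + K) (ζ (k + 2)) u' ≤ _ :=
    bilin_le_of_self_le h.sum_symm h.sum_nonneg h.η_nonneg (h.residual (k + 1)) u'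
  have hz0 : (A + K) (ζ (k + 1)) (-u') ≤ _ :=
    bilin_le_of_self_le h.sum_symm h.sum_nonneg h.η_nonneg (h.residual k) (-u')
  simp only [show k + 1 + 1 = k + 2 from rfl] at hz1
  rw [← hu'] at hz1
  rw [← hu] at hz0
  simp only [map_neg, LinearMap.neg_apply, neg_neg] at hz0
  have hd : φ (k + 2) ≤ _ := h.descent (k + 1)
  simp only [show k + 1 + 1 = k + 2 from rfl] at hd
  rw [← hu'] at hd
  have hg := (abs_le.1 (h.grad_diff k u')).1
  rw [← hu] at hg
  have hdual := h.dual k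
  rw [← hu, ← hu'] at hdual
  have hcoef := h.coef u'
  have hbK := mul_le_mul_of_nonneg_right h.coef_b (h.K_nonneg (u' - u))
  have hW : (A + K) u' u' = A u' u' + K u' u' := rfl
  have hAu := h.A_nonneg u'
  have hKu := h.K_nonneg u'
  -- Descent lemma plus the current optimality condition tested with the step u'; polarization
  -- produces the squares.
  have e1 : φ (k + 2) + A (X (k + 2)) (x (k + 2)) + A (x (k + 2)) (x (k + 2)) / 2 ≤
      φ (k + 1) + A (X (k + 1)) (x (k + 1)) + A (x (k + 1)) (x (k + 1)) / 2
      + A (x (k + 2)) (x (k + 2)) - (A + K) u' u' / 2 + η * (A + K) u' u' + ℓ u' / 2 := by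
    linarith
  -- Difference of two consecutive optimality conditions, tested with u'. The residuals cost η/2
  -- times (A + K)(u', u') three times and (A + K)(u, u) once.
  have e2 : (A (x (k + 2)) (x (k + 2)) + K u' u') / 2 ≤
      (A (x (k + 1)) (x (k + 1)) + K u u) / 2 - K (u' - u) (u' - u) / 2 + ℓ u / 2 + ℓ u' / 2
        + 3 / 2 * (η * (A + K) u' u') + η / 2 * (A + K) u u := by
    linarith
  have e3 := mul_le_mul_of_nonneg_left e2 h.c_nonneg
  linarith

/-- Since x_{n+1} = X_{n+1} - X_n, polarization makes each summand at least half the increment of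
A(X, X), and the sum telescopes from X_0 = 0. -/
theorem sum_coupling_nonneg (h : PrimalDualRun A K ℓ q a b c s η x X ζ g φ φmin) (n : ℕ) :
    A (X n) (X n) / 2 ≤ ∑ k ∈ Finset.range n, A (X (k + 1)) (x (k + 1)) := by
  induction n with
  | zero => simp [h.X_zero]
  | succ n ih =>
    rw [Finset.sum_range_succ]
    have h1 : x (n + 1) = X (n + 1) - X n := by rw [h.X_succ]; abel
    have h2 := bilin_self_sub h.A_symm (X (n + 1)) (X n)
    rw [← h1] at h2
    have h3 := h.A_nonneg (x (n + 1))
    linarith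

/-- Once a decreasing sequence is below p, it stays below by a fixed amount, and its partial sums
above p tend to -∞. -/
theorem le_of_antitone_of_sum_nonneg {P : ℕ → ℝ} (hP : Antitone P) {p : ℝ}
    (hs : ∀ n, 0 ≤ ∑ k ∈ Finset.range n, (P k - p)) (k : ℕ) : p ≤ P k := by
  by_contra! hlt
  have hsum : ∀ n : ℕ, ∑ j ∈ Finset.range (k + n), (P j - p) ≤
      ∑ j ∈ Finset.range k, (P j - p) + n * (P k - p) := by
    intro n
    induction n with
    | zero => simp
    | succ n ih =>
      rw [← add_assoc, Finset.sum_range_succ]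
      have := hP (Nat.le_add_right k n)
      push_cast
      linarith
  obtain ⟨n, hn⟩ := exists_nat_gt ((∑ j ∈ Finset.range k, (P j - p)) / (p - P k))
  rw [div_lt_iff₀ (by linarith)] at hn
  have h1 := hs (k + n)
  have h2 := hsum n
  linarith

theorem potential_antitone (h : PrimalDualRun A K ℓ q a b c s η x X ζ g φ φmin) :
    Antitone (potential A K ℓ q a c s η x X φ) := by
  refine antitone_nat_of_succ_le fun k => ?_
  have h1 := h.potential_succ_le k
  have h2 := h.sum_nonneg (x (k + 2) - x (k + 1))
  have h3 := h.A_nonneg (x (k + 2))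
  linarith

theorem lower_le_potential (h : PrimalDualRun A K ℓ q a b c s η x X ζ g φ φmin) (k : ℕ) :
    φmin ≤ potential A K ℓ q a c s η x X φ k := by
  refine le_of_antitone_of_sum_nonneg h.potential_antitone (fun n => ?_) k
  have h1 := h.sum_coupling_nonneg n
  have h2 := h.A_nonneg (X n)
  refine le_trans (by linarith : 0 ≤ ∑ k ∈ Finset.range n, A (X (k + 1)) (x (k + 1)))
    (Finset.sum_le_sum fun k _ => ?_)
  have h3 := h.lower (k + 1)
  have h4 := h.A_nonneg (x (k + 1))
  have h5 := h.K_nonneg (x (k + 1) - x k)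
  have h6 := h.sum_nonneg (x (k + 1) - x k)
  have h7 := h.ℓ_nonneg (x (k + 1) - x k)
  have h8 := h.q_nonneg (x (k + 1) - x k)
  have := mul_nonneg h.c_nonneg (add_nonneg (add_nonneg (add_nonneg h4 h5) h7)
    (mul_nonneg h.η_nonneg h6))
  have := mul_nonneg h.a_nonneg h8
  have := mul_nonneg h.s_nonneg h6
  unfold potential
  linarith

/-- At the first index both the sum and the step equal x 1. The coupling and violation terms give
3/2 of A, and `coef` bounds the remaining terms by 3/8 of A + K, whence 15/8. -/
theorem potential_zero_le (h : PrimalDualRun A K ℓ q a b c s η x X ζ g φ φmin) :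
    potential A K ℓ q a c s η x X φ 0 ≤ φ 1 + (15 / 8 + c / 2) * (A + K) (x 1) (x 1) := by
  have hX : X 1 = x 1 := by simpa [h.X_zero] using h.X_succ 0
  have h1 := h.coef (x 1)
  have hW : (A + K) (x 1) (x 1) = A (x 1) (x 1) + K (x 1) (x 1) := rfl
  have h0 := h.sum_nonneg (x 1)
  simp only [potential, zero_add, hX, h.x_zero, sub_zero]
  have h2 := h.K_nonneg (x 1)
  have h3 := mul_nonneg h.c_nonneg (h.ℓ_nonneg (x 1))
  have h4 := mul_nonneg (mul_nonneg h.η_nonneg h.c_nonneg) h0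
  have h5 := mul_nonneg h.η_nonneg h0
  have h6 := mul_nonneg h.s_nonneg h0
  have h7 := h.ℓ_nonneg (x 1)
  have h8 : c * (A + K) (x 1) (x 1) = c * A (x 1) (x 1) + c * K (x 1) (x 1) := by rw [hW]; ring
  linarith

theorem sum_le (h : PrimalDualRun A K ℓ q a b c s η x X ζ g φ φmin) (n : ℕ) :
    ∑ k ∈ Finset.range n, (1 / 8 * (A + K) (x (k + 2) - x (k + 1)) (x (k + 2) - x (k + 1))
        + 1 / 3 * A (x (k + 2)) (x (k + 2))) ≤
      φ 1 - φmin + (15 / 8 + c / 2) * (A + K) (x 1) (x 1) := by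
  have h1 : ∑ k ∈ Finset.range n, (1 / 8 * (A + K) (x (k + 2) - x (k + 1)) (x (k + 2) - x (k + 1))
        + 1 / 3 * A (x (k + 2)) (x (k + 2))) ≤
      potential A K ℓ q a c s η x X φ 0 - potential A K ℓ q a c s η x X φ n := by
    rw [← Finset.sum_range_sub']
    refine Finset.sum_le_sum fun k _ => ?_
    have := h.potential_succ_le k
    linarith
  have h2 := h.lower_le_potential n
  have h3 := h.potential_zero_le
  linarith

theorem grad_sq_le (h : PrimalDualRun A K ℓ q a b c s η x X ζ g φ φmin) {v : E}
    (hv : ∀ u, A u v = 0) (k : ℕ) :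
    g k v ^ 2 ≤ K v v * ((1 + η) ^ 2 * (A + K) (x (k + 1) - x k) (x (k + 1) - x k)) := by
  set u := x (k + 1) - x k with hu
  -- As v is in the kernel of A, the accumulated dual term drops out and only the proximal term and
  -- the residual remain.
  have h1 : g k v = K (ζ (k + 1) - u) v := by
    have := h.opt k v
    rw [hv, ← hu] at this
    simp only [LinearMap.add_apply, hv, map_sub, LinearMap.sub_apply] at this ⊢
    linarith
  have h2 : K (ζ (k + 1) - u) (ζ (k + 1) - u) ≤ (1 + η) ^ 2 * (A + K) u u := by
    have h3 : K (ζ (k + 1) - u) (ζ (k + 1) - u) ≤ (A + K) (ζ (k + 1) - u) (ζ (k + 1) - u) :=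
      le_add_of_nonneg_left (h.A_nonneg _)
    have h4 := h.residual k
    have h5 := bilin_le_of_self_le h.sum_symm h.sum_nonneg h.η_nonneg (h.residual k) (-u)
    rw [← hu] at h4 h5
    have h6 : (A + K) (ζ (k + 1) - u) (ζ (k + 1) - u) =
        (A + K) (ζ (k + 1)) (ζ (k + 1)) + 2 * (A + K) (ζ (k + 1)) (-u) + (A + K) u u := by
      simp only [map_sub, map_neg, LinearMap.sub_apply]
      rw [h.sum_symm u (ζ (k + 1))]
      ring
    simp only [map_neg, LinearMap.neg_apply, neg_neg] at h5 h6
    linarith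
  calc g k v ^ 2 ≤ K (ζ (k + 1) - u) (ζ (k + 1) - u) * K v v := by
        rw [h1]; exact bilin_sq_le h.K_symm h.K_nonneg _ _
    _ ≤ _ := by rw [mul_comm]; exact mul_le_mul_of_nonneg_left h2 (h.K_nonneg v)

/-- The size of the first iterate, from a lower bound on the derivative at the origin. -/
theorem first_le (h : PrimalDualRun A K ℓ q a b c s η x X ζ g φ φmin) {m D : ℝ} (hm : 0 < m)
    (hη : η < 1) (hℓ : ∀ v, m * ℓ v ≤ (A + K) v v)
    (hg : ∀ t, 0 < t → ∀ v, -g 0 v ≤ t / 2 * D + 1 / (2 * t) * ℓ v) :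
    (A + K) (x 1) (x 1) ≤ D / (m * (1 - η) ^ 2) := by
  have hη' : 0 < 1 - η := by linarith
  have hX : X 1 = x 1 := by simpa [h.X_zero] using h.X_succ 0
  have h1 := h.opt 0 (x 1)
  simp only [zero_add, hX, h.x_zero, sub_zero] at h1
  have h2 := bilin_le_of_self_le h.sum_symm h.sum_nonneg h.η_nonneg (h.residual 0) (x 1)
  simp only [zero_add, h.x_zero, sub_zero] at h2
  -- This Young weight makes the ℓ-term cost exactly half of the (1 - η)(A + K)(x 1, x 1) available
  -- on the left.
  have h3 := hg (1 / (m * (1 - η))) (by positivity) (x 1)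
  have h4 := hℓ (x 1)
  have hW : (A + K) (x 1) (x 1) = A (x 1) (x 1) + K (x 1) (x 1) := rfl
  set w := (A + K) (x 1) (x 1)
  have h5 : 1 / (2 * (1 / (m * (1 - η)))) * ℓ (x 1) ≤ (1 - η) / 2 * w := by
    rw [show 1 / (2 * (1 / (m * (1 - η)))) * ℓ (x 1) = (1 - η) / 2 * (m * ℓ (x 1)) by field_simp]
    exact mul_le_mul_of_nonneg_left h4 (by linarith)
  have h6 : (1 - η) * w ≤ 1 / (m * (1 - η)) * D := by linarith
  rw [le_div_iff₀ (by positivity)]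
  have h7 := mul_le_mul_of_nonneg_left h6 (show 0 ≤ m * (1 - η) by positivity)
  rw [show m * (1 - η) * (1 / (m * (1 - η)) * D) = D by field_simp] at h7
  linarith

end PrimalDualRun

end Potential

/-! ### Consequences of Lipschitz gradients and of boundedness below. -/

section ProblemClass

variable {M S : ℕ}

/-- The descent lemma for a function with Lipschitz gradient. -/
theorem le_add_inner_gradient {f : Vec S → ℝ} (hf : Differentiable ℝ f) {K : ℝ}
    (hK : ∀ x z, ‖gradient f x - gradient f z‖ ≤ K * ‖x - z‖) (x v : Vec S) :
    f (x + v) ≤ f x + inner ℝ (gradient f x) v + K / 2 * ‖v‖ ^ 2 := by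
  set h : ℝ → ℝ := fun t => f (x + t • v) - t * inner ℝ (gradient f x) v - K / 2 * ‖v‖ ^ 2 * t ^ 2
    with hh
  have hder : ∀ t, HasDerivAt h (inner ℝ (gradient f (x + t • v)) v - inner ℝ (gradient f x) v
      - K / 2 * ‖v‖ ^ 2 * (2 * t)) t := by
    intro t
    have h1 : HasDerivAt (fun t : ℝ => x + t • v) v t := by
      simpa using ((hasDerivAt_id t).smul_const v).const_add x
    have h2 := (hf (x + t • v)).hasGradientAt.hasFDerivAt.comp_hasDerivAt t h1
    have h3 : HasDerivAt (fun t : ℝ => t * inner ℝ (gradient f x) v)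
        (inner ℝ (gradient f x) v) t := by
      simpa using (hasDerivAt_id t).mul_const (inner ℝ (gradient f x) v)
    have h4 : HasDerivAt (fun t : ℝ => K / 2 * ‖v‖ ^ 2 * t ^ 2)
        (K / 2 * ‖v‖ ^ 2 * (2 * t)) t := by
      simpa using (hasDerivAt_pow 2 t).const_mul (K / 2 * ‖v‖ ^ 2)
    have h5 := (h2.sub h3).sub h4
    rw [InnerProductSpace.toDual_apply_apply] at h5
    exact h5
  have hanti : AntitoneOn h (Set.Icc 0 1) := by
    refine antitoneOn_of_hasDerivWithinAt_nonpos (convex_Icc 0 1)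
      (fun t _ => (hder t).continuousAt.continuousWithinAt)
      (fun t _ => (hder t).hasDerivWithinAt) fun t ht => ?_
    rw [interior_Icc] at ht
    have h1 : inner ℝ (gradient f (x + t • v) - gradient f x) v ≤ K * (t * ‖v‖) * ‖v‖ := by
      refine (real_inner_le_norm _ _).trans (mul_le_mul_of_nonneg_right ?_ (norm_nonneg _))
      simpa [norm_smul, abs_of_pos ht.1] using hK (x + t • v) x
    rw [inner_sub_left] at h1
    linarith
  have := hanti (Set.left_mem_Icc.2 zero_le_one) (Set.right_mem_Icc.2 zero_le_one) zero_le_one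
  simp only [hh, one_smul, zero_smul, add_zero] at this
  linarith

/-- A function with Lipschitz constant 0 for its gradient is affine, and an affine function bounded
below is constant. This is what makes the convention 0⁻¹ = 0 in `initEnergy` harmless. -/
theorem gradient_eq_zero_of_bddBelow {f : Vec S → ℝ} (hf : Differentiable ℝ f)
    (hK : ∀ x z, ‖gradient f x - gradient f z‖ ≤ 0 * ‖x - z‖) (hb : BddBelow (Set.range f))
    (x : Vec S) : gradient f x = 0 := by
  obtain ⟨b, hb⟩ := hb
  by_contra hne
  have hpos : 0 < ‖gradient f x‖ ^ 2 := by positivity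
  -- The length of this step along the negative gradient is chosen so that the value becomes at most
  -- b - 1.
  have h1 := le_add_inner_gradient hf hK x (-((f x - b + 1) / ‖gradient f x‖ ^ 2) • gradient f x)
  have h2 : b ≤ _ := hb ⟨x + -((f x - b + 1) / ‖gradient f x‖ ^ 2) • gradient f x, rfl⟩
  rw [inner_smul_right, real_inner_self_eq_norm_sq, neg_mul, div_mul_cancel₀ _ hpos.ne'] at h1
  linarith

/-- All other local variables are frozen at 0. -/
theorem bddBelow_of_objective {f : Fin M → Vec S → ℝ} (hb : BddBelow (Set.range (objective f)))
    (i : Fin M) : BddBelow (Set.range (f i)) := by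
  obtain ⟨b, hb⟩ := hb
  have hM : (0 : ℝ) < M := Nat.cast_pos.2 i.pos
  refine ⟨b * M - ∑ j ∈ Finset.univ.erase i, f j 0, ?_⟩
  rintro _ ⟨v, rfl⟩
  have h1 : b ≤ _ := hb ⟨Function.update 0 i v, rfl⟩
  rw [objective, ← Finset.add_sum_erase _ _ (Finset.mem_univ i), Function.update_self] at h1
  have h2 : ∑ j ∈ Finset.univ.erase i, f j (Function.update (0 : Fin M → Vec S) i v j) =
      ∑ j ∈ Finset.univ.erase i, f j 0 := by
    refine Finset.sum_congr rfl fun j hj => ?_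
    rw [Function.update_of_ne (Finset.ne_of_mem_erase hj)]
    rfl
  rw [h2, one_div_mul_eq_div, le_div_iff₀ hM] at h1
  linarith

/-- The curvature energy `‖v‖²_{L / M}`. -/
def lipEnergy (L : Fin M → ℝ) (v : Fin M → Vec S) : ℝ := ∑ i, L i / M * ‖v i‖ ^ 2

/-- The energy `‖v‖²_{L Υ⁻² L / M²}`. -/
def lipSqEnergy (L β : Fin M → ℝ) (v : Fin M → Vec S) : ℝ :=
  ∑ i, (L i / M) ^ 2 / β i ^ 2 * ‖v i‖ ^ 2

namespace InProblemClass

variable {f : Fin M → Vec S → ℝ} {L : Fin M → ℝ}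

theorem nonneg (hf : InProblemClass f L) (i : Fin M) : 0 ≤ L i := (hf.lipschitz i).1.1

theorem norm_gradient_sub_le (hf : InProblemClass f L) (i : Fin M) (x z : Vec S) :
    ‖gradient (f i) x - gradient (f i) z‖ ≤ L i * ‖x - z‖ := (hf.lipschitz i).1.2 x z

theorem objectiveInf_le (hf : InProblemClass f L) (x : Fin M → Vec S) :
    objectiveInf f ≤ objective f x := ciInf_le hf.bddBelow x

theorem lipEnergy_nonneg (hf : InProblemClass f L) (v : Fin M → Vec S) : 0 ≤ lipEnergy L v :=
  Finset.sum_nonneg fun i _ => by have := hf.nonneg i; positivity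

theorem initEnergy_nonneg (hf : InProblemClass f L) : 0 ≤ initEnergy f L :=
  Finset.sum_nonneg fun i _ => by have := hf.nonneg i; positivity

theorem objective_le (hf : InProblemClass f L) (x y : Fin M → Vec S) :
    objective f y ≤ objective f x + innerForm (stackedGrad f x) (y - x)
      + lipEnergy L (y - x) / 2 := by
  have h : ∀ i, f i (y i) ≤ f i (x i) + inner ℝ (gradient (f i) (x i)) (y i - x i)
      + L i / 2 * ‖y i - x i‖ ^ 2 := fun i => by
    simpa using le_add_inner_gradient (hf.differentiable i) (hf.norm_gradient_sub_le i) (x i)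
      (y i - x i)
  have h2 := mul_le_mul_of_nonneg_left (Finset.sum_le_sum fun i (_ : i ∈ Finset.univ) => h i)
    (show (0 : ℝ) ≤ 1 / M by positivity)
  refine h2.trans_eq ?_
  simp only [objective, innerForm_apply, stackedInner, stackedGrad, lipEnergy,
    Finset.sum_add_distrib, mul_add, Finset.mul_sum, Finset.sum_div, inner_smul_left, Pi.sub_apply,
    RCLike.conj_to_real]
  congr 1
  exact Finset.sum_congr rfl fun i _ => by ring

theorem abs_grad_sub_le (hf : InProblemClass f L) (x y v : Fin M → Vec S) :
    |innerForm (stackedGrad f y) v - innerForm (stackedGrad f x) v| ≤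
      ∑ i, L i / M * ‖y i - x i‖ * ‖v i‖ := by
  simp only [innerForm_apply, stackedInner, stackedGrad, ← Finset.sum_sub_distrib]
  refine (Finset.abs_sum_le_sum_abs _ _).trans (Finset.sum_le_sum fun i _ => ?_)
  rw [← inner_sub_left, ← smul_sub]
  refine (abs_real_inner_le_norm _ _).trans (mul_le_mul_of_nonneg_right ?_ (norm_nonneg _))
  rw [norm_smul, Real.norm_of_nonneg (by positivity), div_mul_eq_mul_div, one_mul,
    div_mul_eq_mul_div]
  exact div_le_div_of_nonneg_right (hf.norm_gradient_sub_le i _ _) (by positivity)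

theorem abs_grad_sub_le_lipEnergy (hf : InProblemClass f L) (x y v : Fin M → Vec S) :
    |innerForm (stackedGrad f y) v - innerForm (stackedGrad f x) v| ≤
      lipEnergy L (y - x) / 2 + lipEnergy L v / 2 := by
  refine (hf.abs_grad_sub_le x y v).trans ?_
  rw [lipEnergy, lipEnergy, Finset.sum_div, Finset.sum_div, ← Finset.sum_add_distrib]
  refine Finset.sum_le_sum fun i _ => ?_
  have h1 : 0 ≤ L i / M := div_nonneg (hf.nonneg i) (by positivity)
  have h2 := mul_nonneg h1 (sq_nonneg (‖y i - x i‖ - ‖v i‖))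
  rw [Pi.sub_apply]
  linarith

/-- Young's inequality with the node weights β, which leaves the test vector measured by Υ², a part
of both choices of K. -/
theorem grad_sub_le_lipSqEnergy (hf : InProblemClass f L) {β : Fin M → ℝ} (hβ : ∀ i, 0 < β i)
    {t : ℝ} (ht : 0 < t) (x y v : Fin M → Vec S) :
    -(innerForm (stackedGrad f y) v - innerForm (stackedGrad f x) v) ≤
      t / 2 * lipSqEnergy L β (y - x) + 1 / (2 * t) * ∑ i, β i ^ 2 * ‖v i‖ ^ 2 := by
  refine (neg_le_abs _).trans ((hf.abs_grad_sub_le x y v).trans ?_)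
  rw [lipSqEnergy, Finset.mul_sum, Finset.mul_sum, ← Finset.sum_add_distrib]
  refine Finset.sum_le_sum fun i _ => ?_
  have h2 := sq_nonneg (t * (L i / M / β i * ‖y i - x i‖) - β i * ‖v i‖)
  have hb := hβ i
  have h3 : t / 2 * ((L i / M) ^ 2 / β i ^ 2 * ‖(y - x) i‖ ^ 2)
      + 1 / (2 * t) * (β i ^ 2 * ‖v i‖ ^ 2) - L i / M * ‖y i - x i‖ * ‖v i‖ =
      (t * (L i / M / β i * ‖y i - x i‖) - β i * ‖v i‖) ^ 2 / (2 * t) := by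
    rw [Pi.sub_apply]
    generalize L i / M = l
    field_simp
    ring
  have h4 : 0 ≤ (t * (L i / M / β i * ‖y i - x i‖) - β i * ‖v i‖) ^ 2 / (2 * t) := by positivity
  linarith

/-- Young's inequality node by node with weight L_i; at a node with L_i = 0 the gradient itself
vanishes. -/
theorem neg_grad_zero_le (hf : InProblemClass f L) {t : ℝ} (ht : 0 < t) (v : Fin M → Vec S) :
    -innerForm (stackedGrad f 0) v ≤
      t / 2 * (initEnergy f L / M) + 1 / (2 * t) * lipEnergy L v := by
  simp only [innerForm_apply, stackedInner, stackedGrad, initEnergy, lipEnergy, Finset.sum_div,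
    Finset.mul_sum, ← Finset.sum_neg_distrib, ← Finset.sum_add_distrib]
  refine Finset.sum_le_sum fun i _ => ?_
  have hM : (0 : ℝ) < M := Nat.cast_pos.2 i.pos
  rw [Pi.zero_apply]
  rcases (hf.nonneg i).eq_or_lt with h0 | hpos
  · have hg := gradient_eq_zero_of_bddBelow (hf.differentiable i)
      (by simpa [← h0] using hf.norm_gradient_sub_le i) (bddBelow_of_objective hf.bddBelow i) 0
    simp [hg, ← h0]
  · set d := gradient (f i) 0
    have h1 : -inner ℝ ((1 / (M : ℝ)) • d) (v i) ≤ 1 / M * (‖d‖ * ‖v i‖) := by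
      rw [inner_smul_left, ← mul_neg]
      refine mul_le_mul_of_nonneg_left ?_ (by simp)
      exact (neg_le_abs _).trans (abs_real_inner_le_norm _ _)
    have h2 : t / 2 * ((L i)⁻¹ * ‖d‖ ^ 2 / M) + 1 / (2 * t) * (L i / M * ‖v i‖ ^ 2)
        - 1 / M * (‖d‖ * ‖v i‖) = (t * ‖d‖ - L i * ‖v i‖) ^ 2 / (2 * t * L i * M) := by
      field_simp
      ring
    have h3 : 0 ≤ (t * ‖d‖ - L i * ‖v i‖) ^ 2 / (2 * t * L i * M) := by positivity
    linarith

end InProblemClass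

end ProblemClass

/-! ### Incidence matrices, Laplacians and the weight matrices. -/

section Graph

variable {M S : ℕ} {G : SimpleGraph (Fin M)} [DecidableRel G.Adj]

/-- The factor P^{1/2} cancels the degree normalization, since the endpoints of an edge have
positive degree. -/
theorem scaledInc_apply (e : Edge G) (v : Fin M) :
    scaledInc G e v = if v = e.1.1 then 1 else if v = e.1.2 then -1 else 0 := by
  rw [scaledInc, Matrix.mul_diagonal, incidence]
  have hdeg : ∀ w, w = e.1.1 ∨ w = e.1.2 → √(G.degree w : ℝ) ≠ 0 := by
    intro w hw
    have hpos : 0 < G.degree w := by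
      rw [SimpleGraph.degree_pos_iff_exists_adj]
      rcases hw with rfl | rfl
      · exact ⟨_, e.2.2⟩
      · exact ⟨_, e.2.2.symm⟩
    positivity
  split_ifs with h1 h2
  · exact one_div_mul_cancel (hdeg v (Or.inl h1))
  · rw [neg_mul, one_div_mul_cancel (hdeg v (Or.inr h2))]
  · simp

theorem absInc_apply (e : Edge G) (v : Fin M) :
    absInc G e v = if v = e.1.1 then 1 else if v = e.1.2 then 1 else 0 := by
  rw [absInc, scaledInc_apply]
  split_ifs <;> simp

theorem sum_scaledInc_smul (e : Edge G) (v : Vec S) : ∑ j, scaledInc G e j • v = 0 := by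
  have hne : e.1.2 ≠ e.1.1 := e.2.1.ne
  have h : ∀ j, scaledInc G e j • v = (if j = e.1.1 then v else 0) - (if j = e.1.2 then v else 0) := by
    intro j
    rw [scaledInc_apply]
    split_ifs with h1 h2 <;> simp_all
  simp [h]

theorem sum_absInc_smul (e : Edge G) (v : Vec S) : ∑ j, absInc G e j • v = (2 : ℝ) • v := by
  have hne : e.1.2 ≠ e.1.1 := e.2.1.ne
  have h : ∀ j, absInc G e j • v = (if j = e.1.1 then v else 0) + (if j = e.1.2 then v else 0) := by
    intro j
    rw [absInc_apply]
    split_ifs with h1 h2 <;> simp_all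
  simp [h, Finset.sum_add_distrib, two_smul]

theorem weightedLap_eq (σ : Edge G → ℝ) :
    weightedLap σ = (sigMat σ * scaledInc G).transpose * (sigMat σ * scaledInc G) := by
  rw [weightedLap, Matrix.transpose_mul, sigMat, Matrix.diagonal_transpose, sq]
  simp only [Matrix.mul_assoc]

theorem absInc_gram_eq (σ : Edge G → ℝ) :
    (absInc G).transpose * sigMat σ ^ 2 * absInc G =
      (sigMat σ * absInc G).transpose * (sigMat σ * absInc G) := by
  rw [Matrix.transpose_mul, sigMat, Matrix.diagonal_transpose, sq]
  simp only [Matrix.mul_assoc]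

theorem weightedLap_posSemidef (σ : Edge G → ℝ) : (weightedLap σ).PosSemidef := by
  rw [weightedLap_eq]
  simpa using Matrix.posSemidef_conjTranspose_mul_self (sigMat σ * scaledInc G)

theorem transpose_mul_diagonal_mul_apply {m n : Type} [Fintype m] [DecidableEq m]
    (B : Matrix m n ℝ) (d : m → ℝ) (i j : n) :
    (B.transpose * Matrix.diagonal d * B) i j = ∑ e, d e * (B e i * B e j) := by
  simp only [Matrix.mul_apply (M := B.transpose * Matrix.diagonal d), Matrix.mul_diagonal,
    Matrix.transpose_apply]
  exact Finset.sum_congr rfl fun e _ => by ring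

/-- Off the diagonal the signed and the unsigned Laplacian are opposite; on the diagonal they agree.
Hence A + H is diagonal, which is where the matrix 2Δ + Υ² of the initialization comes from. -/
theorem weightedLap_add_absInc_gram (σ : Edge G → ℝ) :
    weightedLap σ + (absInc G).transpose * sigMat σ ^ 2 * absInc G = (2 : ℝ) • deltaMat σ := by
  ext i j
  rw [weightedLap, sigMat, Matrix.diagonal_pow, Matrix.add_apply,
    transpose_mul_diagonal_mul_apply, transpose_mul_diagonal_mul_apply, Matrix.smul_apply,
    deltaMat, Matrix.diagonal_apply, ← Finset.sum_add_distrib]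
  split_ifs with hij
  · subst hij
    rw [smul_eq_mul, Finset.mul_sum]
    refine Finset.sum_congr rfl fun e _ => ?_
    rw [scaledInc_apply, absInc_apply, Pi.pow_apply]
    split_ifs <;> simp_all <;> ring
  · rw [smul_zero]
    refine Finset.sum_eq_zero fun e _ => ?_
    have hne : e.1.2 ≠ e.1.1 := e.2.1.ne
    rw [scaledInc_apply, absInc_apply, scaledInc_apply, absInc_apply]
    split_ifs <;> simp_all

theorem form_weightedLap_const (σ : Edge G → ℝ) (u : Fin M → Vec S) (v : Vec S) :
    form (weightedLap σ) u (fun _ => v) = 0 := by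
  have h : act (scaledInc G) (fun _ => v) = 0 := funext fun e => sum_scaledInc_smul e v
  rw [weightedLap_eq, form_transpose_mul_self, mul_act _ _ (fun _ => v), h, act_zero]
  simp [stackedInner]

theorem upsMat_sq (β : Fin M → ℝ) : upsMat β ^ 2 = Matrix.diagonal fun i => β i ^ 2 := by
  rw [upsMat, Matrix.diagonal_pow]; rfl

theorem upsMat_sq_posDef {β : Fin M → ℝ} (hβ : ∀ i, 0 < β i) : (upsMat β ^ 2).PosDef := by
  rw [upsMat_sq]
  exact Matrix.PosDef.diagonal fun i => by have := hβ i; positivity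

theorem upsMat_sq_inv {β : Fin M → ℝ} (hβ : ∀ i, 0 < β i) :
    (upsMat β ^ 2)⁻¹ = Matrix.diagonal fun i => (β i ^ 2)⁻¹ := by
  refine Matrix.inv_eq_right_inv ?_
  rw [upsMat_sq, Matrix.diagonal_mul_diagonal, ← Matrix.diagonal_one]
  congr 1
  funext i
  exact mul_inv_cancel₀ (by have := hβ i; positivity)

theorem form_upsMat_sq (β : Fin M → ℝ) (v : Fin M → Vec S) :
    form (upsMat β ^ 2) v v = ∑ i, β i ^ 2 * ‖v i‖ ^ 2 := by
  rw [upsMat_sq, form_diagonal_self]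

theorem form_upsMat_sq_const (β : Fin M → ℝ) (v : Vec S) :
    form (upsMat β ^ 2) (fun _ => v) (fun _ => v) = (∑ i, β i ^ 2) * ‖v‖ ^ 2 := by
  rw [form_upsMat_sq, Finset.sum_mul]

theorem hMat_posDef (σ : Edge G → ℝ) {β : Fin M → ℝ} (hβ : ∀ i, 0 < β i) :
    (hMat σ β).PosDef := by
  rw [hMat, absInc_gram_eq]
  refine Matrix.PosDef.posSemidef_add ?_ (upsMat_sq_posDef hβ)
  simpa using Matrix.posSemidef_conjTranspose_mul_self (sigMat σ * absInc G)

theorem form_absInc_gram_const (σ : Edge G → ℝ) (v : Vec S) :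
    form ((absInc G).transpose * sigMat σ ^ 2 * absInc G) (fun _ => v) (fun _ => v) =
      4 * (∑ e, σ e ^ 2) * ‖v‖ ^ 2 := by
  have h : act (absInc G) (fun _ => v) = fun _ => (2 : ℝ) • v :=
    funext fun e => sum_absInc_smul e v
  rw [absInc_gram_eq, ← sqNorm_act, mul_act, h, sqNorm, Finset.mul_sum, Finset.sum_mul]
  refine Finset.sum_congr rfl fun e _ => ?_
  rw [sigMat, diagonal_act, norm_smul, norm_smul, mul_pow, mul_pow, Real.norm_eq_abs, sq_abs]
  norm_num
  ring

theorem form_hMat_const (σ : Edge G → ℝ) (β : Fin M → ℝ) (v : Vec S) :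
    form (hMat σ β) (fun _ => v) (fun _ => v) =
      (4 * ∑ e, σ e ^ 2 + ∑ i, β i ^ 2) * ‖v‖ ^ 2 := by
  rw [hMat, form_add, form_absInc_gram_const, form_upsMat_sq_const]
  ring

theorem form_smul_diagonal (L : Fin M → ℝ) (v : Fin M → Vec S) :
    form ((1 / (M : ℝ)) • Matrix.diagonal L) v v = lipEnergy L v := by
  rw [form_smul, form_diagonal_self, lipEnergy, Finset.mul_sum]
  exact Finset.sum_congr rfl fun i _ => by ring

theorem form_smul_diagonal_mul {β : Fin M → ℝ} (hβ : ∀ i, 0 < β i) (L : Fin M → ℝ)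
    (v : Fin M → Vec S) :
    form ((1 / (M : ℝ) ^ 2) • (Matrix.diagonal L * (upsMat β ^ 2)⁻¹ * Matrix.diagonal L)) v v =
      lipSqEnergy L β v := by
  rw [upsMat_sq_inv hβ, Matrix.diagonal_mul_diagonal, Matrix.diagonal_mul_diagonal, form_smul,
    form_diagonal_self, lipSqEnergy, Finset.mul_sum]
  exact Finset.sum_congr rfl fun i _ => by ring

theorem lipSqEnergy_nonneg (L β : Fin M → ℝ) (v : Fin M → Vec S) : 0 ≤ lipSqEnergy L β v :=
  Finset.sum_nonneg fun i _ => by positivity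

theorem gap_eq (σ : Edge G → ℝ) (f : Fin M → Vec S → ℝ) (x : Fin M → Vec S) :
    gap σ f x = ‖∑ i, stackedGrad f x i‖ ^ 2 + form (weightedLap σ) x x := by
  rw [gap, sqNorm_act, ← weightedLap_eq, Finset.smul_sum]
  rfl

theorem innerForm_const (x : Fin M → Vec S) (v : Vec S) :
    innerForm x (fun _ => v) = inner ℝ (∑ i, x i) v := by
  simp [stackedInner, sum_inner]

end Graph

/-- The sum of two forms, kept together as one bilinear form. -/
abbrev formSum {n : Type} [Fintype n] {S : ℕ} (P Q : Matrix n n ℝ) :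
    LinearMap.BilinForm ℝ (n → Vec S) := form P + form Q

/-! ### From summability to the rate of the smallest gap. -/

section Rate

variable {M S : ℕ} {G : SimpleGraph (Fin M)} [DecidableRel G.Adj]

/-- The rate of the smallest gap along an inexact primal-dual run. -/
theorem inf_gap_le {σ : Edge G → ℝ} {f : Fin M → Vec S → ℝ} {P : Matrix (Fin M) (Fin M) ℝ}
    {ℓ q : (Fin M → Vec S) → ℝ} {a b c s η φmin N : ℝ} {x X ζ : ℕ → Fin M → Vec S}
    (h : PrimalDualRun (form (weightedLap σ)) (form P) ℓ q a b c s η x X ζ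
      (fun k => innerForm (stackedGrad f (x k))) (fun k => objective f (x k)) φmin)
    (hN : ∀ v : Vec S, form P (fun _ => v) (fun _ => v) = N * ‖v‖ ^ 2) (hN0 : 0 ≤ N)
    (T : ℕ) (hT : 1 ≤ T) :
    (Finset.Icc 1 T).inf' (Finset.nonempty_Icc.2 hT) (fun r => gap σ f (x (r + 1))) ≤
      (8 * (1 + η) ^ 2 * N + 3) * (objective f (x 1) - φmin + (15 / 8 + c / 2) *
        formSum (weightedLap σ) P (x 1) (x 1)) / T := by
  set ω : LinearMap.BilinForm ℝ (Fin M → Vec S) := formSum (weightedLap σ) P with hω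
  have hωnn : ∀ u, 0 ≤ ω u u := h.sum_nonneg
  have hgrad : ∀ k, ‖∑ i, stackedGrad f (x k) i‖ ^ 2 ≤
      N * (1 + η) ^ 2 * ω (x (k + 1) - x k) (x (k + 1) - x k) := by
    intro k
    set w := ∑ i, stackedGrad f (x k) i with hw
    -- Testing with the block-constant vector built from w itself gives ‖w‖⁴ on the left and a
    -- factor ‖w‖² on the right, which is cancelled unless it is zero.
    have h1 := h.grad_sq_le (v := fun _ => w) (fun u => form_weightedLap_const σ u w) k
    rw [innerForm_const, ← hw, real_inner_self_eq_norm_sq, hN] at h1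
    change _ ≤ _ * (_ * ω _ _) at h1
    rcases (sq_nonneg ‖w‖).eq_or_lt with h0 | hpos
    · rw [← h0]
      exact mul_nonneg (mul_nonneg hN0 (sq_nonneg _)) (hωnn _)
    · refine le_of_mul_le_mul_left ?_ hpos
      linarith
  set ψ := objective f (x 1) - φmin + (15 / 8 + c / 2) * ω (x 1) (x 1) with hψ
  -- One extra term is needed: the gradient at iterate r is controlled by the step leaving it, the
  -- violation by the summand one index earlier.
  have hsum := h.sum_le (T + 1)
  change _ ≤ ψ at hsum
  rw [Finset.sum_add_distrib] at hsum
  change ∑ k ∈ Finset.range (T + 1), 1 / 8 * ω _ _ + _ ≤ ψ at hsum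
  have hA : ∀ k, 0 ≤ form (weightedLap σ) (x k) (x k) := fun k => h.A_nonneg _
  have h1 : ∑ r ∈ Finset.Icc 1 T, ω (x (r + 2) - x (r + 1)) (x (r + 2) - x (r + 1)) ≤
      ∑ k ∈ Finset.range (T + 1), ω (x (k + 2) - x (k + 1)) (x (k + 2) - x (k + 1)) := by
    refine Finset.sum_le_sum_of_subset_of_nonneg (fun r hr => ?_) fun _ _ _ => hωnn _
    rw [Finset.mem_Icc] at hr
    exact Finset.mem_range.2 (by omega)
  have h2 : ∑ r ∈ Finset.Icc 1 T, form (weightedLap σ) (x (r + 1)) (x (r + 1)) ≤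
      ∑ k ∈ Finset.range (T + 1), form (weightedLap σ) (x (k + 2)) (x (k + 2)) := by
    rw [← Finset.Ico_add_one_right_eq_Icc, Finset.sum_Ico_eq_sum_range, Nat.add_sub_cancel,
      Finset.sum_range_succ]
    refine le_add_of_le_of_nonneg (le_of_eq (Finset.sum_congr rfl fun k _ => ?_)) (hA _)
    rw [show 1 + k + 1 = k + 2 by ring]
  have h3 : ∑ r ∈ Finset.Icc 1 T, gap σ f (x (r + 1)) ≤
      N * (1 + η) ^ 2 * ∑ r ∈ Finset.Icc 1 T, ω (x (r + 2) - x (r + 1)) (x (r + 2) - x (r + 1))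
      + ∑ r ∈ Finset.Icc 1 T, form (weightedLap σ) (x (r + 1)) (x (r + 1)) := by
    rw [Finset.mul_sum, ← Finset.sum_add_distrib]
    refine Finset.sum_le_sum fun r _ => ?_
    rw [gap_eq]
    exact add_le_add_left (hgrad (r + 1)) _
  rw [← Finset.mul_sum, ← Finset.mul_sum] at hsum
  have h4 : 0 ≤ ∑ k ∈ Finset.range (T + 1), ω (x (k + 2) - x (k + 1)) (x (k + 2) - x (k + 1)) :=
    Finset.sum_nonneg fun _ _ => hωnn _
  have h5 : 0 ≤ ∑ k ∈ Finset.range (T + 1), form (weightedLap σ) (x (k + 2)) (x (k + 2)) :=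
    Finset.sum_nonneg fun _ _ => hA _
  have hN1 : 0 ≤ N * (1 + η) ^ 2 := by positivity
  have h6 : ∑ r ∈ Finset.Icc 1 T, gap σ f (x (r + 1)) ≤ (8 * (1 + η) ^ 2 * N + 3) * ψ := by
    have h7 := mul_le_mul_of_nonneg_left (h1.trans (by linarith : _ ≤ 8 * ψ)) hN1
    have h8 := h2.trans (by linarith : _ ≤ 3 * ψ)
    linarith
  rw [le_div_iff₀ (by exact_mod_cast hT)]
  refine le_trans ?_ h6
  have hinf : ∀ r ∈ Finset.Icc 1 T, (Finset.Icc 1 T).inf' (Finset.nonempty_Icc.2 hT)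
      (fun r => gap σ f (x (r + 1))) ≤ gap σ f (x (r + 1)) := fun r hr => Finset.inf'_le _ hr
  have h9 := Finset.card_nsmul_le_sum _ _ _ hinf
  rw [Nat.card_Icc, Nat.add_sub_cancel, nsmul_eq_mul, mul_comm] at h9
  exact h9

end Rate

/-! ### D-GPDA as an exact primal-dual run. -/

section DGPDA

/-- First-order optimality for the minimizer of a proximal quadratic model. -/
theorem stationary_of_isMinOn {E : Type*} [AddCommGroup E] [Module ℝ E]
    {A K : LinearMap.BilinForm ℝ E} (hA : ∀ u v, A u v = A v u) (hK : ∀ u v, K u v = K v u)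
    {p : E →ₗ[ℝ] ℝ} {x₀ y : E}
    (h : IsMinOn (fun y => p (y - x₀) + A y y / 2 + K (y - x₀) (y - x₀) / 2) Set.univ y) (v : E) :
    p v + A y v + K (y - x₀) v = 0 := by
  -- Along the line y + t v the increase is a nonnegative quadratic in t without constant term, so
  -- its discriminant, the square of the directional derivative, is at most 0.
  have h1 : ∀ t : ℝ, 0 ≤ (A v v + K v v) / 2 * (t * t) + (p v + A y v + K (y - x₀) v) * t + 0 := by
    intro t
    have h2 : _ ≤ _ := isMinOn_univ_iff.1 h (y + t • v)
    have h3 : y + t • v - x₀ = (y - x₀) + t • v := by abel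
    simp only [h3, map_add, map_smul, LinearMap.add_apply, LinearMap.smul_apply, smul_eq_mul,
      hA v y, hK v (y - x₀)] at h2
    linarith
  have h4 := discrim_le_zero h1
  rw [discrim] at h4
  have : (p v + A y v + K (y - x₀) v) ^ 2 ≤ 0 := by linarith
  exact pow_eq_zero_iff (two_ne_zero) |>.1 (le_antisymm this (sq_nonneg _))

variable {M S : ℕ} {G : SimpleGraph (Fin M)} [DecidableRel G.Adj]
  {L : Fin M → ℝ} {σ : Edge G → ℝ} {β : Fin M → ℝ} {f : Fin M → Vec S → ℝ}

theorem kappa_eq (σ : Edge G → ℝ) (β : Fin M → ℝ) :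
    kappa σ β = 1 / lamMinNonzero
      (sigMat σ * scaledInc G * (hMat σ β)⁻¹ * (sigMat σ * scaledInc G).transpose) := by
  rw [kappa, Matrix.transpose_mul, sigMat, Matrix.diagonal_transpose]
  simp only [Matrix.mul_assoc]

theorem kappa_nonneg (σ : Edge G → ℝ) (hβ : ∀ i, 0 < β i) : 0 ≤ kappa σ β := by
  rw [kappa_eq]
  exact one_div_nonneg.2 (lamMinNonzero_nonneg
    (posSemidef_mul_inv_mul_transpose _ (hMat_posDef σ hβ)))

theorem form_deltaMat_nonneg (σ : Edge G → ℝ) (v : Fin M → Vec S) :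
    0 ≤ form (deltaMat σ) v v := by
  rw [deltaMat, form_diagonal_self]
  refine Finset.sum_nonneg fun i _ => mul_nonneg (Finset.sum_nonneg fun e _ => ?_) (sq_nonneg _)
  split_ifs <;> positivity

theorem form_weightedLap_add_form_hMat (σ : Edge G → ℝ) (β : Fin M → ℝ) (u v : Fin M → Vec S) :
    formSum (weightedLap σ) (hMat σ β) u v =
      form ((2 : ℝ) • deltaMat σ + upsMat β ^ 2) u v := by
  rw [← weightedLap_add_absInc_gram, hMat]
  simp only [formSum, LinearMap.add_apply, form_add]
  ring

namespace DGPDAParams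

theorem form_le (hp : DGPDAParams L σ β) (v : Fin M → Vec S) :
    (1 + 2 * max (6 * kappa σ β) 1) * lipEnergy L v + 4 * kappa σ β * lipSqEnergy L β v ≤
      formSum (weightedLap σ) (hMat σ β) v v / 2 := by
  have h1 := form_nonneg hp.main v
  rw [show 4 * kappa σ β / (M : ℝ) ^ 2 = 4 * kappa σ β * (1 / (M : ℝ) ^ 2) by ring,
    show 2 * max (6 * kappa σ β) 1 / (M : ℝ) = 2 * max (6 * kappa σ β) 1 * (1 / (M : ℝ)) by ring,
    mul_smul (4 * _), mul_smul (2 * max _ _), form_sub, form_sub, form_sub, form_smul, form_smul (4 * _),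
    form_smul (2 * _), form_smul_diagonal_mul hp.beta_pos, form_smul_diagonal, form_add] at h1
  have h2 := form_deltaMat_nonneg σ v
  rw [form_weightedLap_add_form_hMat, form_add, form_smul]
  linarith

end DGPDAParams

/-- The primal iterates of D-GPDA, shifted by one and preceded by the zero initialization. -/
def shiftIter (x : ℕ → Fin M → Vec S) : ℕ → Fin M → Vec S
  | 0 => 0
  | k + 1 => x k

theorem form_hMat_upsMat_le (σ : Edge G → ℝ) (β : Fin M → ℝ) (v : Fin M → Vec S) :
    form (upsMat β ^ 2) v v ≤ form (hMat σ β) v v := by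
  rw [hMat, form_add, absInc_gram_eq, ← sqNorm_act]
  exact le_add_of_nonneg_left (sqNorm_nonneg _)

namespace IsDGPDARun

variable {x : ℕ → Fin M → Vec S} {mu : ℕ → Edge G → Vec S}

theorem mu_eq (hr : IsDGPDARun σ β f x mu) (r : ℕ) :
    mu r = act (sigMat σ ^ 2 * scaledInc G) (∑ j ∈ Finset.range (r + 1), x j) := by
  induction r with
  | zero => simpa using hr.init_mu
  | succ r ih => rw [hr.step_mu, ih, Finset.sum_range_succ _ (r + 1), act_add]

theorem optimality (hr : IsDGPDARun σ β f x mu) (hβ : ∀ i, 0 < β i) (k : ℕ) (v : Fin M → Vec S) :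
    innerForm (stackedGrad f (shiftIter x k)) v
      + form (weightedLap σ) (∑ j ∈ Finset.range (k + 1), x j) v
      + form (hMat σ β) (shiftIter x (k + 1) - shiftIter x k) v = 0 := by
  cases k with
  -- The equation for x⁰ is the optimality condition from x = 0 and zero dual variable, because 2Δ +
  -- Υ² = A + H.
  | zero =>
    have h1 := congrArg (fun y => stackedInner v y) hr.init_x
    simp only [stackedInner_add] at h1
    rw [stackedInner_comm, stackedInner_comm v, ← form_apply,
      ← form_weightedLap_add_form_hMat] at h1
    simp only [shiftIter, innerForm_apply, zero_add, Finset.sum_range_one, sub_zero]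
    simp only [formSum, LinearMap.add_apply] at h1
    rw [add_assoc, h1]
    simp [stackedInner]
  | succ r =>
    have hp : ∀ v, (innerForm (stackedGrad f (x r)) + form (weightedLap σ)
        (∑ j ∈ Finset.range (r + 1), x j)) v =
        stackedInner (stackedGrad f (x r) + act (scaledInc G).transpose (mu r)) v := by
      intro v
      rw [hr.mu_eq, ← mul_act, ← Matrix.mul_assoc, stackedInner_comm, stackedInner_add,
        stackedInner_comm v, stackedInner_comm v]
      rfl
    have hmin := stationary_of_isMinOn (A := form (weightedLap σ)) (K := form (hMat σ β))
      (p := innerForm (stackedGrad f (x r)) + form (weightedLap σ)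
        (∑ j ∈ Finset.range (r + 1), x j)) (x₀ := x r) (y := x (r + 1))
      (fun u v => form_comm (weightedLap_posSemidef σ).1 u v)
      (fun u v => form_comm (hMat_posDef σ hβ).1 u v) ?_ v
    · rw [Finset.sum_range_succ _ (r + 1), map_add]
      simp only [shiftIter, LinearMap.add_apply] at hmin ⊢
      linarith
    · convert hr.step_x r using 2 with y
      rw [hp, dgpdaModel, sqNorm_act, ← weightedLap_eq, sqNorm_act, ← absInc_gram_eq, sqNorm_act,
        hMat, form_add, upsMat, Matrix.diagonal_transpose, ← sq]
      ring

theorem primalDualRun (hr : IsDGPDARun σ β f x mu) (hp : DGPDAParams L σ β)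
    (hf : InProblemClass f L) :
    PrimalDualRun (form (weightedLap σ)) (form (hMat σ β)) (lipEnergy L) (lipSqEnergy L β)
      (2 * kappa σ β) (2 * kappa σ β) (max (6 * kappa σ β) 1) 0 0 (shiftIter x)
      (fun k => ∑ j ∈ Finset.range k, x j) (fun _ => 0)
      (fun k => innerForm (stackedGrad f (shiftIter x k)))
      (fun k => objective f (shiftIter x k)) (objectiveInf f) where
  A_symm := form_comm (weightedLap_posSemidef σ).1
  K_symm := form_comm (hMat_posDef σ hp.beta_pos).1
  A_nonneg := form_nonneg (weightedLap_posSemidef σ)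
  K_nonneg := form_nonneg (hMat_posDef σ hp.beta_pos).posSemidef
  ℓ_nonneg := hf.lipEnergy_nonneg
  q_nonneg := lipSqEnergy_nonneg L β
  a_nonneg := mul_nonneg zero_le_two (kappa_nonneg σ hp.beta_pos)
  c_nonneg := le_max_of_le_right zero_le_one
  s_nonneg := le_rfl
  η_nonneg := le_rfl
  x_zero := rfl
  X_zero := rfl
  X_succ k := Finset.sum_range_succ _ _
  opt k v := by rw [hr.optimality hp.beta_pos, map_zero, LinearMap.zero_apply]
  residual k := by simp
  descent k := hf.objective_le _ _
  grad_diff k v := hf.abs_grad_sub_le_lipEnergy _ _ _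
  dual k := by
    obtain ⟨z, hz, hle⟩ := exists_riesz (sigMat σ * scaledInc G) (hMat_posDef σ hp.beta_pos)
      (shiftIter x (k + 2))
    rw [← weightedLap_eq, ← kappa_eq] at hle
    rw [← weightedLap_eq] at hz
    have h0 := hr.optimality hp.beta_pos k z
    have h1 := hr.optimality hp.beta_pos (k + 1) z
    rw [Finset.sum_range_succ _ (k + 1), map_add, LinearMap.add_apply] at h1
    have hX : form (weightedLap σ) (x (k + 1)) z = form (hMat σ β) z z := hz z
    set w := (shiftIter x (k + 2) - shiftIter x (k + 1)) - (shiftIter x (k + 1) - shiftIter x k)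
      with hw
    -- Young weight 2 here and in `h4`: each term costs a quarter of H(z, z), so half of it survives
    -- and both constants become 2κ.
    have h2 := hf.grad_sub_le_lipSqEnergy hp.beta_pos zero_lt_two (shiftIter x k)
      (shiftIter x (k + 1)) z
    rw [← form_upsMat_sq] at h2
    have h3 := form_hMat_upsMat_le σ β z
    have h4 := bilin_le_young (A := form (hMat σ β))
      (form_comm (hMat_posDef σ hp.beta_pos).1)
      (form_nonneg (hMat_posDef σ hp.beta_pos).posSemidef) zero_lt_two (-w) z
    simp only [map_neg, LinearMap.neg_apply, neg_neg] at h4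
    have h5 : form (hMat σ β) w z =
        form (hMat σ β) (shiftIter x (k + 2) - shiftIter x (k + 1)) z
        - form (hMat σ β) (shiftIter x (k + 1) - shiftIter x k) z := by
      rw [hw, map_sub, LinearMap.sub_apply]
    have h6 : form (hMat σ β) z z ≤ 2 * lipSqEnergy L β (shiftIter x (k + 1) - shiftIter x k)
        + 2 * form (hMat σ β) w w := by
      simp only [show k + 1 + 1 = k + 2 from rfl] at h1
      linarith
    have h7 := hle.trans (mul_le_mul_of_nonneg_left h6 (kappa_nonneg σ hp.beta_pos))
    linarith
  lower k := hf.objectiveInf_le _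
  coef_b := by
    have := le_max_left (6 * kappa σ β) 1
    have := kappa_nonneg σ hp.beta_pos
    linarith
  coef v := by
    have h1 := hp.form_le v
    have h2 := mul_nonneg (kappa_nonneg σ hp.beta_pos) (lipSqEnergy_nonneg L β v)
    have h3 : 0 ≤ max (6 * kappa σ β) 1 := le_max_of_le_right zero_le_one
    have h4 := mul_nonneg h3 (hf.lipEnergy_nonneg v)
    have h5 := hf.lipEnergy_nonneg v
    have h6 : 0 ≤ formSum (weightedLap σ) (hMat σ β) v v := by
      have : 0 ≤ 4 * kappa σ β * lipSqEnergy L β v := by linarith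
      linarith
    linarith

theorem inf_gap_le (hr : IsDGPDARun σ β f x mu) (hp : DGPDAParams L σ β)
    (hf : InProblemClass f L) (T : ℕ) (hT : 1 ≤ T) :
    (Finset.Icc 1 T).inf' (Finset.nonempty_Icc.2 hT) (fun r => gap σ f (x r)) ≤
      (8 * (objective f (x 0) - objectiveInf f + 2 / (M : ℝ) * initEnergy f L))
        * (4 * ∑ e, σ e ^ 2 + ∑ i, β i ^ 2 + 4) / (T : ℝ) := by
  have h := hr.primalDualRun hp hf
  set c := max (6 * kappa σ β) 1 with hc
  have hc1 : 1 ≤ c := le_max_right _ _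
  have hN : 0 ≤ 4 * ∑ e, σ e ^ 2 + ∑ i, β i ^ 2 := by positivity
  refine (DistOpt.inf_gap_le h (form_hMat_const σ β) hN T hT).trans ?_
  refine div_le_div_of_nonneg_right ?_ (Nat.cast_nonneg T)
  have hfirst := h.first_le (m := 2 + 4 * c) (D := initEnergy f L / M) (by linarith) zero_lt_one
    (fun v => by
      have h1 := hp.form_le v
      have h2 := mul_nonneg (kappa_nonneg σ hp.beta_pos) (lipSqEnergy_nonneg L β v)
      rw [← hc] at h1
      linarith)
    (fun t ht v => hf.neg_grad_zero_le ht v)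
  change formSum (weightedLap σ) (hMat σ β) (x 0) (x 0) ≤ _ at hfirst
  change (8 * (1 + 0) ^ 2 * _ + 3) * (objective f (x 0) - objectiveInf f + (15 / 8 + c / 2) *
    formSum (weightedLap σ) (hMat σ β) (x 0) (x 0)) ≤ _
  have hD : 0 ≤ initEnergy f L / M := div_nonneg hf.initEnergy_nonneg (Nat.cast_nonneg M)
  have h1 : (15 / 8 + c / 2) * formSum (weightedLap σ) (hMat σ β) (x 0) (x 0) ≤
      2 * (initEnergy f L / M) := by
    rw [sub_zero, one_pow, mul_one, le_div_iff₀ (by linarith)] at hfirst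
    have h0 : 0 ≤ formSum (weightedLap σ) (hMat σ β) (x 0) (x 0) := h.sum_nonneg _
    have h2 := mul_nonneg (sub_nonneg.2 hc1) h0
    linarith
  have h2 := hf.objectiveInf_le (x 0)
  have h3 : 2 / (M : ℝ) * initEnergy f L = 2 * (initEnergy f L / M) := by ring
  rw [h3]
  set N := 4 * ∑ e, σ e ^ 2 + ∑ i, β i ^ 2
  calc _ ≤ (8 * (N + 4)) * (objective f (x 0) - objectiveInf f + 2 * (initEnergy f L / M)) :=
        mul_le_mul (by linarith) (by linarith)
          (add_nonneg (by linarith) (mul_nonneg (by linarith) (h.sum_nonneg _))) (by linarith)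
    _ = _ := by ring

end IsDGPDARun

end DGPDA

/-! ### Convergence of the Chebyshev inner iteration. -/

section Chebyshev

/-- Closed form of the Chebyshev weights for `ρ = 2 ε / (1 + ε ^ 2)`. -/
theorem chebyWeight_eq (ε : ℝ) (k : ℕ) :
    chebyWeight (2 * ε / (1 + ε ^ 2)) k =
      (1 + ε ^ 2) * (1 + (ε ^ k) ^ 2) / (1 + (ε ^ (k + 1)) ^ 2) := by
  have h1 : 1 + ε ^ 2 ≠ 0 := by positivity
  induction k with
  | zero =>
    simp only [chebyWeight, pow_zero, zero_add, pow_one]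
    field_simp
    norm_num
  | succ k ih =>
    have h2 : 1 + (ε ^ (k + 1)) ^ 2 ≠ 0 := by positivity
    have h3 : 1 + (ε ^ (k + 1 + 1)) ^ 2 ≠ 0 := by positivity
    rw [chebyWeight, ih]
    have h4 : 4 - (2 * ε / (1 + ε ^ 2)) ^ 2 *
        ((1 + ε ^ 2) * (1 + (ε ^ k) ^ 2) / (1 + (ε ^ (k + 1)) ^ 2)) =
        4 * (1 + (ε ^ (k + 1 + 1)) ^ 2) / ((1 + ε ^ 2) * (1 + (ε ^ (k + 1)) ^ 2)) := by
      rw [pow_succ ε (k + 1), pow_succ ε k] at *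
      generalize ε ^ k = y at *
      field_simp
      ring
    rw [h4]
    field_simp

/-- The residual polynomials of the Chebyshev iteration at `ρ cos φ`. -/
def chebyFactor (ε φ : ℝ) (q : ℕ) : ℝ := 2 * ε ^ q * Real.cos (q * φ) / (1 + (ε ^ q) ^ 2)

theorem chebyFactor_zero (ε φ : ℝ) : chebyFactor ε φ 0 = 1 := by
  norm_num [chebyFactor]

theorem chebyFactor_one (ε φ : ℝ) :
    chebyFactor ε φ 1 = 2 * ε / (1 + ε ^ 2) * Real.cos φ := by
  simp [chebyFactor]; ring

/-- For ε = e^{-t} the factor is cos(qφ) / cosh(qt), that is T_q(cos φ) / T_q(1/ρ), and the relation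
is the three-term recurrence of T_q. Writing everything in powers of ε keeps the limiting case ε =
0, where the condition number is 1. -/
theorem chebyFactor_add_two (ε φ : ℝ) (q : ℕ) :
    chebyFactor ε φ (q + 2) =
      chebyWeight (2 * ε / (1 + ε ^ 2)) (q + 1) * (2 * ε / (1 + ε ^ 2) * Real.cos φ) *
        chebyFactor ε φ (q + 1)
      + (1 - chebyWeight (2 * ε / (1 + ε ^ 2)) (q + 1)) * chebyFactor ε φ q := by
  have hcos : Real.cos ((q + 2 : ℕ) * φ) =
      2 * Real.cos φ * Real.cos ((q + 1 : ℕ) * φ) - Real.cos (q * φ) := by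
    have h1 := Real.cos_add ((q + 1 : ℕ) * φ) φ
    have h2 := Real.cos_sub ((q + 1 : ℕ) * φ) φ
    rw [show ((q + 1 : ℕ) : ℝ) * φ + φ = (q + 2 : ℕ) * φ by push_cast; ring] at h1
    rw [show ((q + 1 : ℕ) : ℝ) * φ - φ = q * φ by push_cast; ring] at h2
    linarith
  rw [chebyWeight_eq, chebyFactor, chebyFactor, chebyFactor, hcos]
  generalize Real.cos ((q + 1 : ℕ) * φ) = C1
  generalize Real.cos ((q : ℝ) * φ) = C0
  have h1 : 1 + ε ^ 2 ≠ 0 := by positivity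
  have h2 : 1 + (ε ^ q) ^ 2 ≠ 0 := by positivity
  have h3 : 1 + (ε ^ (q + 1)) ^ 2 ≠ 0 := by positivity
  have h4 : 1 + (ε ^ (q + 2)) ^ 2 ≠ 0 := by positivity
  rw [show q + 1 + 1 = q + 2 from rfl]
  rw [pow_succ ε (q + 1), pow_succ ε q] at *
  generalize ε ^ q = y at *
  field_simp
  ring

theorem abs_chebyFactor_le {ε : ℝ} (hε : 0 ≤ ε) (φ : ℝ) (q : ℕ) :
    |chebyFactor ε φ q| ≤ 2 * ε ^ q := by
  have h0 : 0 ≤ 2 * ε ^ q := by positivity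
  rw [chebyFactor, abs_div, abs_mul, abs_of_nonneg h0,
    abs_of_pos (by positivity : 0 < 1 + (ε ^ q) ^ 2)]
  refine (div_le_self (by positivity) (by nlinarith [sq_nonneg (ε ^ q)])).trans ?_
  exact mul_le_of_le_one_right h0 (Real.abs_cos_le_one _)

theorem exists_eq_mul_cos {ρ μ : ℝ} (h : |μ| ≤ ρ) : ∃ φ, μ = ρ * Real.cos φ := by
  rcases ((abs_nonneg μ).trans h).eq_or_lt with h0 | hpos
  · exact ⟨0, by rw [← h0] at h ⊢; simpa using h⟩
  · refine ⟨Real.arccos (μ / ρ), ?_⟩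
    have h1 := abs_le.1 h
    rw [Real.cos_arccos ((le_div_iff₀ hpos).2 (by linarith)) ((div_le_one hpos).2 h1.2)]
    field_simp

variable {M S : ℕ}

/-- An eigencomponent of the error of the Chebyshev iteration. -/
theorem act_chebyIter_sub {R V : Matrix (Fin M) (Fin M) ℝ} {lam : Fin M → ℝ}
    (hV : V * R = Matrix.diagonal lam * V) {τ ε φ : ℝ} {j : Fin M}
    (hφ : 1 - τ * lam j = 2 * ε / (1 + ε ^ 2) * Real.cos φ) (xs u₀ : Fin M → Vec S) :
    ∀ q : ℕ, act V (chebyIter R τ (2 * ε / (1 + ε ^ 2)) (act R xs) u₀ q - xs) j =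
      chebyFactor ε φ q • act V (u₀ - xs) j := by
  have hR : ∀ y : Fin M → Vec S, act V (act (1 - τ • R) y) j =
      (2 * ε / (1 + ε ^ 2) * Real.cos φ) • act V y j := by
    intro y
    rw [← hφ, sub_act, smul_act, one_act, act_sub, act_smul, ← mul_act, hV, mul_act, Pi.sub_apply,
      Pi.smul_apply, diagonal_act, sub_smul, one_smul, mul_smul]
  have hxs : act (1 - τ • R) xs = xs - τ • act R xs := by
    rw [sub_act, smul_act, one_act]
  set ρ := 2 * ε / (1 + ε ^ 2) with hρ
  intro q
  induction q using Nat.twoStepInduction with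
  | zero => rw [chebyFactor_zero, one_smul, chebyIter]
  | one =>
    have h : chebyIter R τ ρ (act R xs) u₀ 1 - xs = act (1 - τ • R) (u₀ - xs) := by
      rw [chebyIter, act_sub, hxs]
      module
    rw [h, hR, chebyFactor_one]
  | more q ih0 ih1 =>
    set α := chebyWeight ρ (q + 1) with hα
    set y1 := chebyIter R τ ρ (act R xs) u₀ (q + 1) with hy1
    set y0 := chebyIter R τ ρ (act R xs) u₀ q with hy0
    have h : chebyIter R τ ρ (act R xs) u₀ (q + 2) - xs =
        α • act (1 - τ • R) (y1 - xs) + (1 - α) • (y0 - xs) := by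
      rw [chebyIter, ← hα, ← hy1, ← hy0, act_sub, hxs]
      module
    rw [h, act_add, act_smul, act_smul, Pi.add_apply, Pi.smul_apply, Pi.smul_apply, hR, ih0, ih1,
      chebyFactor_add_two, ← hρ, ← hα, smul_smul, smul_smul, smul_smul, ← add_smul]

/-- Simultaneous diagonalization of `W` and of `R = Υ⁻² W`. -/
theorem exists_simultaneous_diagonalization {W : Matrix (Fin M) (Fin M) ℝ} (hW : W.PosDef)
    {β : Fin M → ℝ} (hβ : ∀ i, 0 < β i) :
    ∃ (V : Matrix (Fin M) (Fin M) ℝ) (lam : Fin M → ℝ),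
      V * ((upsMat β ^ 2)⁻¹ * W) = Matrix.diagonal lam * V ∧
      W = V.transpose * Matrix.diagonal lam * V ∧
      spectrum ℝ ((upsMat β ^ 2)⁻¹ * W) = Set.range lam ∧ ∀ j, 0 < lam j := by
  set D : Matrix (Fin M) (Fin M) ℝ := Matrix.diagonal fun i => (β i)⁻¹ with hD
  have hDu : D * upsMat β = 1 := by
    rw [hD, upsMat, Matrix.diagonal_mul_diagonal, ← Matrix.diagonal_one]
    congr 1; funext i; exact inv_mul_cancel₀ (hβ i).ne'
  have huD : upsMat β * D = 1 := by
    rw [hD, upsMat, Matrix.diagonal_mul_diagonal, ← Matrix.diagonal_one]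
    congr 1; funext i; exact mul_inv_cancel₀ (hβ i).ne'
  have hinv : (upsMat β ^ 2)⁻¹ = D * D := by
    refine Matrix.inv_eq_right_inv ?_
    rw [sq, Matrix.mul_assoc, ← Matrix.mul_assoc (upsMat β) D, huD, Matrix.one_mul, huD]
  have hDt : D.transpose = D := Matrix.diagonal_transpose _
  have hut : (upsMat β).transpose = upsMat β := Matrix.diagonal_transpose _
  set Rs := D * W * D with hRs
  have hWR : W = upsMat β * Rs * upsMat β := by
    calc W = (upsMat β * D) * W * (D * upsMat β) := by rw [huD, hDu]; simp
      _ = _ := by rw [hRs]; simp only [Matrix.mul_assoc]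
  have hR : (upsMat β ^ 2)⁻¹ * W = D * Rs * upsMat β := by
    calc (upsMat β ^ 2)⁻¹ * W = D * (D * W) * 1 := by rw [hinv]; simp [Matrix.mul_assoc]
      _ = _ := by rw [← hDu, hRs]; simp only [Matrix.mul_assoc]
  have hRsd : Rs.PosDef := by
    have hu : IsUnit D := ⟨⟨D, upsMat β, hDu, huD⟩, rfl⟩
    have := (Matrix.IsUnit.posDef_star_left_conjugate_iff hu (x := W)).2 hW
    rwa [Matrix.star_eq_conjTranspose, Matrix.conjTranspose_eq_transpose_of_trivial, hDt] at this
  obtain ⟨O, d, hO, hO', hd, hs⟩ := exists_diagonalization hRsd.1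
  obtain ⟨d', hs', hd'⟩ := spectrum_eq_range_of_posDef hRsd
  -- R = Υ⁻²W is similar to the symmetric matrix Υ⁻¹WΥ⁻¹ = Oᵀ diag(d) O; the basis O Υ diagonalizes
  -- R by similarity and W by congruence.
  refine ⟨O * upsMat β, d, ?_, ?_, ?_, fun j => ?_⟩
  · have h1 : O * Rs = Matrix.diagonal d * O := by
      rw [hd, ← Matrix.mul_assoc, ← Matrix.mul_assoc, hO', Matrix.one_mul]
    calc O * upsMat β * ((upsMat β ^ 2)⁻¹ * W) = O * (upsMat β * D) * Rs * upsMat β := by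
          rw [hR]; simp only [Matrix.mul_assoc]
      _ = _ := by rw [huD, Matrix.mul_one, h1, Matrix.mul_assoc]
  · conv_lhs => rw [hWR, hd]
    rw [Matrix.transpose_mul, hut]
    simp only [Matrix.mul_assoc]
  · rw [hR, ← hs]
    exact spectrum.units_conjugate (u := ⟨D, upsMat β, hDu, huD⟩) (a := Rs)
  · have : d j ∈ Set.range d' := by rw [← hs', hs]; exact ⟨j, rfl⟩
    obtain ⟨i, hi⟩ := this
    rw [← hi]; exact hd' i

/-- Contraction of the Chebyshev iteration in the norm of `W`. -/
theorem form_chebyIter_sub_le {W : Matrix (Fin M) (Fin M) ℝ} (hW : W.PosDef) (hM : 0 < M)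
    {β : Fin M → ℝ} (hβ : ∀ i, 0 < β i) {R : Matrix (Fin M) (Fin M) ℝ}
    (hR : R = (upsMat β ^ 2)⁻¹ * W) {ε : ℝ}
    (hε : ε = (1 - √(eigRatio R)) / (1 + √(eigRatio R))) (xs u₀ : Fin M → Vec S) (q : ℕ) :
    form W (chebyIter R (chebyStep R) (chebyRho R) (act R xs) u₀ q - xs)
        (chebyIter R (chebyStep R) (chebyRho R) (act R xs) u₀ q - xs) ≤
      (2 * ε ^ q) ^ 2 * form W (u₀ - xs) (u₀ - xs) := by
  have : Nonempty (Fin M) := ⟨⟨0, hM⟩⟩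
  obtain ⟨V, lam, hV, hWV, hs, hlam⟩ := exists_simultaneous_diagonalization hW hβ
  rw [← hR] at hV hs
  have hξ := eigRatio_mem_Ioc hs hlam
  have hmin := lamMin_pos hs hlam
  have hmax := hmin.trans_le (lamMin_le_lamMax hs)
  have hs1 : √(eigRatio R) ≤ 1 := Real.sqrt_le_one.2 hξ.2
  have hs2 : √(eigRatio R) ^ 2 = eigRatio R := Real.sq_sqrt hξ.1.le
  have hε0 : 0 ≤ ε := by
    rw [hε]; exact div_nonneg (by linarith) (by positivity)
  have hρ : chebyRho R = 2 * ε / (1 + ε ^ 2) := by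
    have := Real.sqrt_nonneg (eigRatio R)
    rw [chebyRho, hε]
    generalize √(eigRatio R) = s at *
    rw [← hs2]
    have h1 : 1 + s ≠ 0 := by positivity
    have h2 : (1 + s) ^ 2 + (1 - s) ^ 2 ≠ 0 := by positivity
    field_simp
    ring
  have hρ' : chebyRho R = (lamMax R - lamMin R) / (lamMin R + lamMax R) := by
    rw [chebyRho, eigRatio]
    field_simp
    ring_nf
  have hform : ∀ z : Fin M → Vec S, form W z z = ∑ j, lam j * ‖act V z j‖ ^ 2 := fun z => by
    rw [hWV, form_transpose_mul, form_diagonal_self]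
  rw [hform, hform, Finset.mul_sum]
  refine Finset.sum_le_sum fun j _ => ?_
  have hmem : lam j ∈ spectrum ℝ R := hs ▸ ⟨j, rfl⟩
  have hfin : (spectrum ℝ R).Finite := hs ▸ Set.finite_range lam
  have hl1 : lamMin R ≤ lam j := csInf_le hfin.bddBelow hmem
  have hl2 : lam j ≤ lamMax R := le_csSup hfin.bddAbove hmem
  -- The step τ maps [λ_min, λ_max] onto [-ρ₀, ρ₀], so every eigenvalue corresponds to an angle; ε
  -- does not depend on it.
  obtain ⟨φ, hφ⟩ : ∃ φ, 1 - chebyStep R * lam j = chebyRho R * Real.cos φ := by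
    refine exists_eq_mul_cos ?_
    have h1 : 1 - chebyStep R * lam j =
        (lamMin R + lamMax R - 2 * lam j) / (lamMin R + lamMax R) := by
      rw [chebyStep]; field_simp
    rw [h1, hρ', abs_div, abs_of_pos (by linarith : 0 < lamMin R + lamMax R)]
    refine div_le_div_of_nonneg_right (abs_le.2 ⟨by linarith, by linarith⟩) (by linarith)
  rw [hρ] at hφ ⊢
  rw [act_chebyIter_sub hV hφ, norm_smul, mul_pow, Real.norm_eq_abs]
  have h2 := pow_le_pow_left₀ (abs_nonneg _) (abs_chebyFactor_le hε0 φ q) 2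
  have h3 := mul_le_mul_of_nonneg_right h2
    (mul_nonneg (hlam j).le (sq_nonneg ‖act V (u₀ - xs) j‖))
  linarith

/-- The difference of the two sides vanishes at 0 and has derivative 1 - e^{-2s}(1 + 2s) ≥ 0. -/
theorem one_sub_le_exp_mul {s : ℝ} (hs : 0 ≤ s) : 1 - s ≤ Real.exp (-2 * s) * (1 + s) := by
  have hmono : MonotoneOn (fun s : ℝ => Real.exp (-2 * s) * (1 + s) - (1 - s)) (Set.Ici 0) := by
    have hder : ∀ s : ℝ, HasDerivAt (fun s : ℝ => Real.exp (-2 * s) * (1 + s) - (1 - s))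
        (Real.exp (-2 * s) * (-2) * (1 + s) + Real.exp (-2 * s) - (-1)) s := by
      intro s
      have h1 : HasDerivAt (fun s : ℝ => -2 * s) (-2) s := by
        simpa using (hasDerivAt_id s).const_mul (-2 : ℝ)
      have h2 : HasDerivAt (fun s : ℝ => 1 + s) 1 s := (hasDerivAt_id s).const_add 1
      have h3 : HasDerivAt (fun s : ℝ => 1 - s) (-1) s := (hasDerivAt_id s).const_sub 1
      have h4 := (h1.exp.mul h2).sub h3
      rw [mul_one] at h4
      exact h4
    refine monotoneOn_of_hasDerivWithinAt_nonneg (convex_Ici 0)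
      (fun s _ => (hder s).continuousAt.continuousWithinAt)
      (fun s _ => (hder s).hasDerivWithinAt) fun s _ => ?_
    have h1 := Real.add_one_le_exp (2 * s)
    have h2 : Real.exp (-2 * s) * Real.exp (2 * s) = 1 := by
      rw [← Real.exp_add]; simp
    have h3 := mul_le_mul_of_nonneg_left h1 (Real.exp_pos (-2 * s)).le
    linarith
  have := hmono Set.self_mem_Ici hs hs
  simp only [mul_zero, Real.exp_zero] at this
  linarith

/-- The number of Chebyshev steps that reduces the error below a prescribed level. -/
theorem sq_pow_le_of_le {ξ B : ℝ} (hξ : ξ ∈ Set.Ioc 0 1) (hB : 0 < B) {Q : ℕ}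
    (hQ : -(1 / 4) * Real.log B * √(1 / ξ) ≤ Q) :
    (((1 - √ξ) / (1 + √ξ)) ^ Q) ^ 2 ≤ B := by
  have hs : 0 < √ξ := Real.sqrt_pos.2 hξ.1
  have hs1 : √ξ ≤ 1 := Real.sqrt_le_one.2 hξ.2
  have h1 : (1 - √ξ) / (1 + √ξ) ≤ Real.exp (-2 * √ξ) :=
    (div_le_iff₀ (by positivity)).2 (one_sub_le_exp_mul hs.le)
  have h0 : 0 ≤ (1 - √ξ) / (1 + √ξ) := div_nonneg (by linarith) (by positivity)
  rw [one_div ξ, Real.sqrt_inv, ← div_eq_mul_inv, div_le_iff₀ hs] at hQ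
  calc (((1 - √ξ) / (1 + √ξ)) ^ Q) ^ 2 ≤ (Real.exp (-2 * √ξ) ^ Q) ^ 2 := by gcongr
    _ = Real.exp (-(4 * (Q * √ξ))) := by
      rw [← pow_mul, ← Real.exp_nat_mul]; congr 1; push_cast; ring
    _ ≤ Real.exp (Real.log B) := Real.exp_le_exp.2 (by linarith)
    _ = B := Real.exp_log hB

end Chebyshev

/-! ### xFILTER as an inexact primal-dual run. -/

section XFilter

variable {M S : ℕ} {G : SimpleGraph (Fin M)} [DecidableRel G.Adj]
  {L : Fin M → ℝ} {σ : Edge G → ℝ} {β : Fin M → ℝ} {f : Fin M → Vec S → ℝ}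

theorem kappaTilde_eq (σ : Edge G → ℝ) (β : Fin M → ℝ) :
    kappaTilde σ β = 1 / lamMinNonzero
      (sigMat σ * scaledInc G * (upsMat β ^ 2)⁻¹ * (sigMat σ * scaledInc G).transpose) := by
  rw [kappaTilde, Matrix.transpose_mul, sigMat, Matrix.diagonal_transpose]
  simp only [Matrix.mul_assoc]

theorem kappaTilde_nonneg (σ : Edge G → ℝ) (hβ : ∀ i, 0 < β i) : 0 ≤ kappaTilde σ β := by
  rw [kappaTilde_eq]
  exact one_div_nonneg.2 (lamMinNonzero_nonneg
    (posSemidef_mul_inv_mul_transpose _ (upsMat_sq_posDef hβ)))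

theorem upsMat_sq_inv_mul (hβ : ∀ i, 0 < β i) : (upsMat β ^ 2)⁻¹ * upsMat β ^ 2 = 1 :=
  Matrix.nonsing_inv_mul _ ((Matrix.isUnit_iff_isUnit_det _).1 (upsMat_sq_posDef hβ).isUnit)

theorem upsMat_sq_mul_inv (hβ : ∀ i, 0 < β i) : upsMat β ^ 2 * (upsMat β ^ 2)⁻¹ = 1 :=
  Matrix.mul_nonsing_inv _ ((Matrix.isUnit_iff_isUnit_det _).1 (upsMat_sq_posDef hβ).isUnit)

theorem rMat_eq (σ : Edge G → ℝ) (hβ : ∀ i, 0 < β i) :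
    rMat σ β = (upsMat β ^ 2)⁻¹ * (weightedLap σ + upsMat β ^ 2) := by
  rw [rMat, Matrix.mul_add, upsMat_sq_inv_mul hβ]

theorem upsMat_sq_mul_rMat (σ : Edge G → ℝ) (hβ : ∀ i, 0 < β i) :
    upsMat β ^ 2 * rMat σ β = weightedLap σ + upsMat β ^ 2 := by
  rw [rMat_eq σ hβ, ← Matrix.mul_assoc, upsMat_sq_mul_inv hβ, Matrix.one_mul]

theorem weightedLap_add_upsMat_sq_posDef (σ : Edge G → ℝ) (hβ : ∀ i, 0 < β i) :
    (weightedLap σ + upsMat β ^ 2).PosDef :=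
  Matrix.PosDef.posSemidef_add (weightedLap_posSemidef σ) (upsMat_sq_posDef hβ)

theorem formSum_apply {n : Type} [Fintype n] (P Q : Matrix n n ℝ) (u v : n → Vec S) :
    formSum P Q u v = form (P + Q) u v := (form_add P Q u v).symm

theorem XFilterParams.form_le (hp : XFilterParams L σ β) (v : Fin M → Vec S) :
    (1 + 16 * kappaTilde σ β) * lipEnergy L v + 6 * kappaTilde σ β * lipSqEnergy L β v ≤
      (1 / 4 - 11 * kappaTilde σ β) * formSum (weightedLap σ) (upsMat β ^ 2) v v := by
  have h1 := form_nonneg hp.main v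
  rw [show 6 * kappaTilde σ β / (M : ℝ) ^ 2 = 6 * kappaTilde σ β * (1 / (M : ℝ) ^ 2) by ring,
    show (1 + 2 * (8 * kappaTilde σ β)) / (M : ℝ) =
      (1 + 16 * kappaTilde σ β) * (1 / (M : ℝ)) by ring,
    mul_smul (6 * _), mul_smul (1 + _), form_sub, form_sub, form_smul, form_smul (6 * _),
    form_smul (1 + _), form_smul_diagonal_mul hp.beta_pos, form_smul_diagonal,
    upsMat_sq_mul_rMat σ hp.beta_pos, ← formSum_apply] at h1
  linarith

/-- The ratio of `λ_max(Υ² R)` and `λ_min(Υ²)`. -/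
def condBound (σ : Edge G → ℝ) (β : Fin M → ℝ) : ℝ :=
  lamMax (upsMat β ^ 2 * rMat σ β) / lamMin (upsMat β ^ 2)

theorem condBound_pos (hM : 0 < M) (σ : Edge G → ℝ) (hβ : ∀ i, 0 < β i) :
    0 < condBound σ β := by
  have : Nonempty (Fin M) := ⟨⟨0, hM⟩⟩
  obtain ⟨d, hs, hd⟩ := spectrum_eq_range_of_posDef (upsMat_sq_posDef hβ)
  obtain ⟨d', hs', hd'⟩ := spectrum_eq_range_of_posDef (weightedLap_add_upsMat_sq_posDef σ hβ)
  rw [condBound, upsMat_sq_mul_rMat σ hβ]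
  exact div_pos ((lamMin_pos hs' hd').trans_le (lamMin_le_lamMax hs')) (lamMin_pos hs hd)

/-- Needed because the residual is measured by A + Υ², while the dual bound can absorb only Υ²(z,
z). -/
theorem form_le_condBound (hM : 0 < M) (σ : Edge G → ℝ) (hβ : ∀ i, 0 < β i)
    (z : Fin M → Vec S) :
    formSum (weightedLap σ) (upsMat β ^ 2) z z ≤ condBound σ β * form (upsMat β ^ 2) z z := by
  have : Nonempty (Fin M) := ⟨⟨0, hM⟩⟩
  obtain ⟨d, hs, hd⟩ := spectrum_eq_range_of_posDef (upsMat_sq_posDef hβ)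
  obtain ⟨d', hs', hd'⟩ := spectrum_eq_range_of_posDef (weightedLap_add_upsMat_sq_posDef σ hβ)
  have h1 := form_le_lamMax (weightedLap_add_upsMat_sq_posDef σ hβ).1 z
  have h2 := lamMin_le_form (upsMat_sq_posDef hβ).1 z
  have h3 := lamMin_pos hs hd
  have h4 := (lamMin_pos hs' hd').trans_le (lamMin_le_lamMax hs')
  rw [formSum_apply, condBound, upsMat_sq_mul_rMat σ hβ, div_mul_eq_mul_div, le_div_iff₀ h3]
  have h5 := mul_le_mul_of_nonneg_left h2 h4.le
  have h6 := mul_le_mul_of_nonneg_right h1 h3.le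
  linarith

/-- The accuracy reached by the prescribed number of Chebyshev steps. -/
theorem cheby_accuracy (hM : 2 ≤ M) (hβ : ∀ i, 0 < β i) {Q : ℕ} (hQ : innerSteps σ β ≤ Q) :
    let δ := 2 * ((1 - √(eigRatio (rMat σ β))) / (1 + √(eigRatio (rMat σ β)))) ^ Q
    δ ^ 2 ≤ 1 / 64 ∧ condBound σ β * δ ^ 2 ≤ 1 / 64 := by
  intro δ
  have : Nonempty (Fin M) := ⟨⟨0, by omega⟩⟩
  obtain ⟨d, hs, hd⟩ := spectrum_eq_range_of_posDef (upsMat_sq_posDef hβ)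
  obtain ⟨d', hs', hd'⟩ := spectrum_eq_range_of_posDef (weightedLap_add_upsMat_sq_posDef σ hβ)
  obtain ⟨V, lam, -, -, hsR, hlam⟩ := exists_simultaneous_diagonalization
    (weightedLap_add_upsMat_sq_posDef σ hβ) hβ
  rw [← rMat_eq σ hβ] at hsR
  rw [← upsMat_sq_mul_rMat σ hβ] at hs'
  have hmin := lamMin_pos hs hd
  have hmax := (lamMin_pos hs' hd').trans_le (lamMin_le_lamMax hs')
  have hθ1 := eigRatio_mem_Ioc hs hd
  have hθ2 := eigRatio_mem_Ioc hs' hd'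
  have hm : 0 < min 1 (lamMin (upsMat β ^ 2)) := lt_min one_pos hmin
  have hθpos : 0 < thetaConst σ β := mul_pos (mul_pos hθ2.1 hθ1.1) hm
  have hθle : thetaConst σ β ≤ min 1 (lamMin (upsMat β ^ 2)) :=
    mul_le_of_le_one_left hm.le (mul_le_one₀ hθ2.2 hθ1.1.le hθ1.2)
  have hθone := hθle.trans (min_le_left _ _)
  have hθlam := hθle.trans (min_le_right _ _)
  have hθsq : thetaConst σ β ^ 2 ≤ 1 := pow_le_one₀ hθpos.le hθone
  have hθsq' : thetaConst σ β ^ 2 ≤ lamMin (upsMat β ^ 2) :=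
    (pow_le_of_le_one hθpos.le hθone two_ne_zero).trans hθlam
  set K := 16 + 128 * (M : ℝ) * max (lamMax (upsMat β ^ 2 * rMat σ β)) 1 with hK
  have hM' : (2 : ℝ) ≤ M := by exact_mod_cast hM
  have hK1 : 16 + 256 * max (lamMax (upsMat β ^ 2 * rMat σ β)) 1 ≤ K := by
    have h1 : 0 < max (lamMax (upsMat β ^ 2 * rMat σ β)) 1 := lt_max_of_lt_right one_pos
    have := mul_le_mul_of_nonneg_right hM' h1.le
    rw [hK]; linarith
  have hKpos : 0 < K := by
    have := le_max_right (lamMax (upsMat β ^ 2 * rMat σ β)) 1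
    linarith
  have h1 := sq_pow_le_of_le (eigRatio_mem_Ioc hsR hlam)
    (div_pos (pow_pos hθpos 2) hKpos) hQ
  have hδ : δ ^ 2 ≤ 4 * thetaConst σ β ^ 2 / K := by
    rw [mul_pow, mul_div_assoc]
    norm_num
    exact h1
  constructor
  · refine hδ.trans ((div_le_iff₀ hKpos).2 ?_)
    have := le_max_right (lamMax (upsMat β ^ 2 * rMat σ β)) 1
    linarith
  -- One factor θ is spent on λ_min(Υ²), the denominator of `condBound`; the remaining λ_max(Υ²R) is
  -- beaten by the coefficient 128 M ≥ 256.
  · have h2 : condBound σ β * lamMin (upsMat β ^ 2) = lamMax (upsMat β ^ 2 * rMat σ β) := by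
      rw [condBound]; field_simp
    have hc := condBound_pos (by omega) σ hβ
    have h3 := mul_le_mul_of_nonneg_left hδ hc.le
    refine h3.trans ?_
    rw [← mul_div_assoc, div_le_iff₀ hKpos]
    have h4 := mul_le_mul_of_nonneg_left hθsq' hc.le
    have := le_max_left (lamMax (upsMat β ^ 2 * rMat σ β)) 1
    linarith

/-- A contraction towards `xs` leaves a residual that is small compared with the step. -/
theorem residual_le_of_contraction {E : Type*} [AddCommGroup E] [Module ℝ E]
    {A : LinearMap.BilinForm ℝ E} (hA : ∀ u v, A u v = A v u) (h0 : ∀ u, 0 ≤ A u u) {δ : ℝ}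
    (hδ : δ ^ 2 ≤ 1 / 64) {z u : E} (h : A z z ≤ δ ^ 2 * A (z - u) (z - u)) :
    A z z ≤ 64 / 49 * δ ^ 2 * A u u := by
  -- With weight 7 the term 8 δ² A(z, z) is at most A(z, z) / 8, which can be absorbed. For δ² =
  -- 1/64 the final factor is 1/49, the source of η = 1/7.
  have h1 := bilin_le_young hA h0 (by norm_num : (0 : ℝ) < 7) z (-u)
  have h2 : A (z - u) (z - u) ≤ 8 * A z z + 8 / 7 * A u u := by
    simp only [map_neg, LinearMap.neg_apply, neg_neg] at h1
    simp only [map_sub, LinearMap.sub_apply, hA u z]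
    linarith
  have h3 := mul_le_mul_of_nonneg_left h2 (sq_nonneg δ)
  have h4 := mul_le_mul_of_nonneg_right hδ (h0 z)
  linarith

section Iterates

variable (σ : Edge G → ℝ) (β : Fin M → ℝ) (f : Fin M → Vec S → ℝ) (Q : ℕ)

/-- The primal iterates of xFILTER, from iteration `-1` on. -/
def xfilterX (k : ℕ) : Fin M → Vec S := (xfilterState σ β f Q k).x

/-- The sum of the first iterates of xFILTER. -/
def xfilterSum (k : ℕ) : Fin M → Vec S := ∑ j ∈ Finset.range k, xfilterX σ β f Q (j + 1)

/-- The exact solution of the linear system of an outer iteration. -/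
def xfilterExact (k : ℕ) : Fin M → Vec S :=
  act ((weightedLap σ + upsMat β ^ 2)⁻¹ * upsMat β ^ 2) (xfilterState σ β f Q k).d

/-- The inexactness of an outer iteration. -/
def xfilterResidual : ℕ → Fin M → Vec S
  | 0 => 0
  | k + 1 => xfilterX σ β f Q (k + 1) - xfilterExact σ β f Q k

variable {σ β f Q}

theorem xfilterState_xt (k : ℕ) : (xfilterState σ β f Q k).xt =
    xfilterX σ β f Q k - act (upsMat β ^ 2)⁻¹ (stackedGrad f (xfilterX σ β f Q k)) := by
  cases k <;> rfl

/-- The tracking recursion telescopes: the predictions cancel except the latest, and the Laplacian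
terms accumulate on the sum of the iterates. -/
theorem xfilterState_d (k : ℕ) : (xfilterState σ β f Q k).d =
    xfilterX σ β f Q k - act (upsMat β ^ 2)⁻¹ (stackedGrad f (xfilterX σ β f Q k))
      - act ((upsMat β ^ 2)⁻¹ * weightedLap σ) (xfilterSum σ β f Q k) := by
  induction k with
  | zero => simp [xfilterState, xfilterX, xfilterSum, act_zero]
  | succ k ih =>
    have h : (xfilterState σ β f Q (k + 1)).d = (xfilterState σ β f Q k).d
        + ((xfilterState σ β f Q (k + 1)).xt - (xfilterState σ β f Q k).xt)
        - act ((upsMat β ^ 2)⁻¹ * weightedLap σ) (xfilterX σ β f Q (k + 1)) := rfl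
    rw [h, ih, xfilterState_xt, xfilterState_xt, xfilterSum, xfilterSum, Finset.sum_range_succ,
      act_add]
    abel

theorem act_xfilterExact (hβ : ∀ i, 0 < β i) (k : ℕ) :
    act (weightedLap σ + upsMat β ^ 2) (xfilterExact σ β f Q k) =
      act (upsMat β ^ 2) (xfilterState σ β f Q k).d := by
  rw [xfilterExact, ← mul_act, ← Matrix.mul_assoc, Matrix.mul_nonsing_inv, Matrix.one_mul]
  exact (Matrix.isUnit_iff_isUnit_det _).1 (weightedLap_add_upsMat_sq_posDef σ hβ).isUnit

theorem act_rMat_xfilterExact (hβ : ∀ i, 0 < β i) (k : ℕ) :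
    act (rMat σ β) (xfilterExact σ β f Q k) = (xfilterState σ β f Q k).d := by
  rw [rMat_eq σ hβ, mul_act, act_xfilterExact hβ, ← mul_act, upsMat_sq_inv_mul hβ, one_act]

/-- Multiplying the linear system R x = d by Υ² yields the optimality condition for its exact
solution; the actual iterate differs by the residual. -/
theorem xfilter_optimality (hβ : ∀ i, 0 < β i) (k : ℕ) (v : Fin M → Vec S) :
    innerForm (stackedGrad f (xfilterX σ β f Q k)) v
      + form (weightedLap σ) (xfilterSum σ β f Q (k + 1)) v
      + form (upsMat β ^ 2) (xfilterX σ β f Q (k + 1) - xfilterX σ β f Q k) v =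
    formSum (weightedLap σ) (upsMat β ^ 2) (xfilterResidual σ β f Q (k + 1)) v := by
  have h1 : act (upsMat β ^ 2) (xfilterState σ β f Q k).d =
      act (upsMat β ^ 2) (xfilterX σ β f Q k) - stackedGrad f (xfilterX σ β f Q k)
        - act (weightedLap σ) (xfilterSum σ β f Q k) := by
    rw [xfilterState_d, act_sub, act_sub, ← mul_act, ← mul_act, ← Matrix.mul_assoc,
      upsMat_sq_mul_inv hβ, one_act, Matrix.one_mul]
  have h2 : form (weightedLap σ + upsMat β ^ 2) (xfilterExact σ β f Q k) v =
      form (upsMat β ^ 2) (xfilterX σ β f Q k) v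
        - innerForm (stackedGrad f (xfilterX σ β f Q k)) v
        - form (weightedLap σ) (xfilterSum σ β f Q k) v := by
    rw [form_apply, act_xfilterExact hβ, h1, stackedInner_comm, ← innerForm_apply, map_sub,
      map_sub]
    simp only [innerForm_apply, form_apply, stackedInner_comm v]
  rw [xfilterResidual, map_sub (formSum _ _), LinearMap.sub_apply, formSum_apply, formSum_apply, h2,
    xfilterSum, Finset.sum_range_succ, ← xfilterSum, map_add, form_add, map_sub,
    LinearMap.sub_apply, LinearMap.add_apply]
  ring

theorem formSum_upsMat_symm (hβ : ∀ i, 0 < β i) (u v : Fin M → Vec S) :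
    formSum (weightedLap σ) (upsMat β ^ 2) u v = formSum (weightedLap σ) (upsMat β ^ 2) v u := by
  rw [formSum_apply, formSum_apply, form_comm (weightedLap_add_upsMat_sq_posDef σ hβ).1]

theorem formSum_upsMat_nonneg (hβ : ∀ i, 0 < β i) (u : Fin M → Vec S) :
    0 ≤ formSum (weightedLap σ) (upsMat β ^ 2) u u := by
  rw [formSum_apply]
  exact form_nonneg (weightedLap_add_upsMat_sq_posDef σ hβ).posSemidef u

theorem xfilter_residual_le (hM : 2 ≤ M) (hβ : ∀ i, 0 < β i) (hQ : innerSteps σ β ≤ Q) (k : ℕ) :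
    let w := formSum (S := S) (weightedLap σ) (upsMat β ^ 2)
    let ζ := xfilterResidual σ β f Q (k + 1)
    let u := xfilterX σ β f Q (k + 1) - xfilterX σ β f Q k
    w ζ ζ ≤ (1 / 7) ^ 2 * w u u ∧ condBound σ β * w ζ ζ ≤ 1 / 49 * w u u := by
  intro w ζ u
  obtain ⟨h1, h2⟩ := cheby_accuracy hM hβ hQ
  set ε := (1 - √(eigRatio (rMat σ β))) / (1 + √(eigRatio (rMat σ β))) with hε
  have hcontr := form_chebyIter_sub_le (weightedLap_add_upsMat_sq_posDef σ hβ) (by omega) hβ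
    (rMat_eq σ hβ) hε (xfilterExact σ β f Q k) (xfilterX σ β f Q k) Q
  rw [act_rMat_xfilterExact hβ] at hcontr
  have hζ : chebyIter (rMat σ β) (chebyStep (rMat σ β)) (chebyRho (rMat σ β))
      (xfilterState σ β f Q k).d (xfilterX σ β f Q k) Q - xfilterExact σ β f Q k = ζ := rfl
  have hu : xfilterX σ β f Q k - xfilterExact σ β f Q k = ζ - u := by
    simp only [ζ, u, xfilterResidual]; abel
  rw [hζ, hu, ← formSum_apply, ← formSum_apply] at hcontr
  have h3 : w ζ ζ ≤ _ := residual_le_of_contraction (formSum_upsMat_symm hβ)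
    (formSum_upsMat_nonneg hβ) h1 hcontr
  have hu0 : 0 ≤ w u u := formSum_upsMat_nonneg hβ u
  constructor
  · have h4 := mul_le_mul_of_nonneg_right h1 hu0
    change w ζ ζ ≤ 64 / 49 * (2 * ε ^ Q) ^ 2 * w u u at h3
    linarith
  · have h4 := mul_le_mul_of_nonneg_right h2 hu0
    have h5 := mul_le_mul_of_nonneg_left h3 (condBound_pos (by omega) σ hβ).le
    change _ ≤ _ * (64 / 49 * (2 * ε ^ Q) ^ 2 * w u u) at h5
    linarith

theorem xfilter_dual_le (hM : 2 ≤ M) (hp : XFilterParams L σ β) (hf : InProblemClass f L)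
    (hQ : innerSteps σ β ≤ Q) (k : ℕ) :
    let x := xfilterX σ β f Q
    let ω := formSum (S := S) (weightedLap σ) (upsMat β ^ 2)
    form (weightedLap σ) (x (k + 2)) (x (k + 2)) ≤
      3 * kappaTilde σ β * lipSqEnergy L β (x (k + 1) - x k)
      + 3 * kappaTilde σ β * form (upsMat β ^ 2)
          ((x (k + 2) - x (k + 1)) - (x (k + 1) - x k))
          ((x (k + 2) - x (k + 1)) - (x (k + 1) - x k))
      + 6 / 49 * kappaTilde σ β * (ω (x (k + 2) - x (k + 1)) (x (k + 2) - x (k + 1))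
        + ω (x (k + 1) - x k) (x (k + 1) - x k)) := by
  intro x ω
  have hβ := hp.beta_pos
  obtain ⟨z, hz, hle⟩ := exists_riesz (sigMat σ * scaledInc G) (upsMat_sq_posDef hβ) (x (k + 2))
  rw [← weightedLap_eq, ← kappaTilde_eq] at hle
  rw [← weightedLap_eq] at hz
  have h0 := xfilter_optimality (f := f) (Q := Q) (σ := σ) hβ k z
  have h1 := xfilter_optimality (f := f) (Q := Q) (σ := σ) hβ (k + 1) z
  rw [xfilterSum, Finset.sum_range_succ, ← xfilterSum, map_add, LinearMap.add_apply] at h1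
  have hX : form (weightedLap σ) (xfilterX σ β f Q (k + 1 + 1)) z = form (upsMat β ^ 2) z z := hz z
  set w := (x (k + 2) - x (k + 1)) - (x (k + 1) - x k) with hw
  set ζ := xfilterResidual σ β f Q (k + 1)
  set ζ' := xfilterResidual σ β f Q (k + 2)
  have hρ := condBound_pos (by omega : 0 < M) σ hβ
  set ρ := condBound σ β
  have h2 := hf.grad_sub_le_lipSqEnergy hβ three_pos (x k) (x (k + 1)) z
  rw [← form_upsMat_sq] at h2
  have h4 := bilin_le_young (A := form (upsMat β ^ 2)) (form_comm (upsMat_sq_posDef hβ).1)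
    (form_nonneg (upsMat_sq_posDef hβ).posSemidef) three_pos (-w) z
  simp only [map_neg, LinearMap.neg_apply, neg_neg] at h4
  have h5 : form (upsMat β ^ 2) w z = form (upsMat β ^ 2) (x (k + 2) - x (k + 1)) z
      - form (upsMat β ^ 2) (x (k + 1) - x k) z := by
    rw [hw, map_sub, LinearMap.sub_apply]
  -- The weight 3ρ compensates the loss ρ in passing from A + Υ² to Υ². The three Young estimates
  -- then cost a sixth of Υ²(z, z) each, and the factor ρ falls on the residuals, which
  -- `cheby_accuracy` makes small even after this multiplication.
  have h6 : ω (ζ' - ζ) z ≤ 3 * ρ / 2 * ω (ζ' - ζ) (ζ' - ζ) + 1 / (2 * (3 * ρ)) * ω z z :=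
    bilin_le_young (formSum_upsMat_symm hβ) (formSum_upsMat_nonneg hβ) (by positivity) _ z
  have h7 : 1 / (2 * (3 * ρ)) * ω z z ≤ form (upsMat β ^ 2) z z / 6 := by
    have h8 := mul_le_mul_of_nonneg_left (form_le_condBound (by omega) σ hβ z)
      (show 0 ≤ 1 / (2 * (3 * ρ)) by positivity)
    refine h8.trans_eq ?_
    change 1 / (2 * (3 * ρ)) * (ρ * _) = _
    field_simp
    ring
  have h8 : ω (ζ' - ζ) z = ω ζ' z - ω ζ z := by rw [map_sub, LinearMap.sub_apply]
  have h9 : ω (ζ' - ζ) (ζ' - ζ) ≤ 2 * ω ζ' ζ' + 2 * ω ζ ζ :=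
    bilin_sub_self_le (formSum_upsMat_nonneg hβ) _ _
  have h10 : ρ * ω ζ ζ ≤ 1 / 49 * ω (x (k + 1) - x k) (x (k + 1) - x k) :=
    (xfilter_residual_le (f := f) hM hβ hQ k).2
  have h11 : ρ * ω ζ' ζ' ≤ 1 / 49 * ω (x (k + 2) - x (k + 1)) (x (k + 2) - x (k + 1)) :=
    (xfilter_residual_le (f := f) hM hβ hQ (k + 1)).2
  have h12 := mul_le_mul_of_nonneg_left h9 hρ.le
  change innerForm (stackedGrad f (x k)) z + form (weightedLap σ) (xfilterSum σ β f Q (k + 1)) z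
    + form (upsMat β ^ 2) (x (k + 1) - x k) z = ω ζ z at h0
  change innerForm (stackedGrad f (x (k + 1))) z + (form (weightedLap σ)
    (xfilterSum σ β f Q (k + 1)) z + form (weightedLap σ) (xfilterX σ β f Q (k + 1 + 1)) z)
    + form (upsMat β ^ 2) (x (k + 2) - x (k + 1)) z = ω ζ' z at h1
  have h13 : form (upsMat β ^ 2) z z ≤ 3 * lipSqEnergy L β (x (k + 1) - x k)
      + 3 * form (upsMat β ^ 2) w w + 6 / 49 * (ω (x (k + 2) - x (k + 1)) (x (k + 2) - x (k + 1))
        + ω (x (k + 1) - x k) (x (k + 1) - x k)) := by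
    linarith
  have h14 := hle.trans (mul_le_mul_of_nonneg_left h13 (kappaTilde_nonneg σ hβ))
  linarith

theorem xfilter_primalDualRun (hM : 2 ≤ M) (hp : XFilterParams L σ β) (hf : InProblemClass f L)
    (hQ : innerSteps σ β ≤ Q) :
    PrimalDualRun (form (weightedLap σ)) (form (upsMat β ^ 2)) (lipEnergy L) (lipSqEnergy L β)
      (3 * kappaTilde σ β) (3 * kappaTilde σ β) (8 * kappaTilde σ β)
      (6 / 49 * kappaTilde σ β) (1 / 7) (xfilterX σ β f Q) (xfilterSum σ β f Q)
      (xfilterResidual σ β f Q) (fun k => innerForm (stackedGrad f (xfilterX σ β f Q k)))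
      (fun k => objective f (xfilterX σ β f Q k)) (objectiveInf f) where
  A_symm := form_comm (weightedLap_posSemidef σ).1
  K_symm := form_comm (upsMat_sq_posDef hp.beta_pos).1
  A_nonneg := form_nonneg (weightedLap_posSemidef σ)
  K_nonneg := form_nonneg (upsMat_sq_posDef hp.beta_pos).posSemidef
  ℓ_nonneg := hf.lipEnergy_nonneg
  q_nonneg := lipSqEnergy_nonneg L β
  a_nonneg := mul_nonneg (by norm_num) (kappaTilde_nonneg σ hp.beta_pos)
  c_nonneg := mul_nonneg (by norm_num) (kappaTilde_nonneg σ hp.beta_pos)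
  s_nonneg := mul_nonneg (by norm_num) (kappaTilde_nonneg σ hp.beta_pos)
  η_nonneg := by norm_num
  x_zero := rfl
  X_zero := rfl
  X_succ k := Finset.sum_range_succ _ _
  opt k v := xfilter_optimality hp.beta_pos k v
  residual k := (xfilter_residual_le hM hp.beta_pos hQ k).1
  descent k := hf.objective_le _ _
  grad_diff k v := hf.abs_grad_sub_le_lipEnergy _ _ _
  dual k := xfilter_dual_le hM hp hf hQ k
  lower k := hf.objectiveInf_le _
  -- Equality: 4/3 · 3κ̃ = 8κ̃ / 2, which explains c̃ = 8κ̃.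
  coef_b := by linarith
  coef v := by
    have h0 := kappaTilde_nonneg σ hp.beta_pos
    have h1 := hp.form_le v
    have h2 := mul_nonneg h0 (lipSqEnergy_nonneg L β v)
    have h4 := mul_nonneg h0 (hf.lipEnergy_nonneg v)
    have h5 := hf.lipEnergy_nonneg v
    have h6 : 0 ≤ formSum (weightedLap σ) (upsMat β ^ 2) v v := formSum_upsMat_nonneg hp.beta_pos v
    have h7 := mul_nonneg h0 h6
    change _ + _ * formSum (weightedLap σ) (upsMat β ^ 2) v v ≤
      _ * formSum (weightedLap σ) (upsMat β ^ 2) v v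
    linarith

theorem xfilter_inf_gap_le (hM : 2 ≤ M) (hp : XFilterParams L σ β) (hf : InProblemClass f L)
    (hQ : innerSteps σ β ≤ Q) (T : ℕ) (hT : 1 ≤ T) :
    (Finset.Icc 1 T).inf' (Finset.nonempty_Icc.2 hT)
        (fun r => gap σ f (xfilterIter σ β f Q r)) ≤
      (objective f (xfilterIter σ β f Q 0) - objectiveInf f + 5 / (M : ℝ) * initEnergy f L)
        * (128 * (∑ i, β i ^ 2 + 3 + 1 / (32 * kappaTilde σ β))) / (T : ℝ) := by
  have h := xfilter_primalDualRun hM hp hf hQ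
  have hN : 0 ≤ ∑ i, β i ^ 2 := by positivity
  refine (inf_gap_le h (form_upsMat_sq_const β) hN T hT).trans ?_
  refine div_le_div_of_nonneg_right ?_ (Nat.cast_nonneg T)
  change _ * (objective f (xfilterIter σ β f Q 0) - objectiveInf f
    + (15 / 8 + 8 * kappaTilde σ β / 2) *
      formSum (weightedLap σ) (upsMat β ^ 2) (xfilterIter σ β f Q 0) (xfilterIter σ β f Q 0)) ≤ _
  have h0 := kappaTilde_nonneg σ hp.beta_pos
  have hsmall : ∀ v : Fin M → Vec S,
      lipEnergy L v + 11 * kappaTilde σ β * formSum (weightedLap σ) (upsMat β ^ 2) v v ≤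
        1 / 4 * formSum (weightedLap σ) (upsMat β ^ 2) v v := fun v => by
    have h1 := hp.form_le v
    have h2 := mul_nonneg h0 (lipSqEnergy_nonneg L β v)
    have h3 := mul_nonneg h0 (hf.lipEnergy_nonneg v)
    linarith
  have hfirst : formSum (weightedLap σ) (upsMat β ^ 2) (xfilterIter σ β f Q 0)
      (xfilterIter σ β f Q 0) ≤ _ :=
    h.first_le (m := 4) (D := initEnergy f L / M) (by norm_num) (by norm_num)
      (fun v => by
        have h1 := hsmall v
        have h2 := mul_nonneg h0 (formSum_upsMat_nonneg (σ := σ) hp.beta_pos v)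
        change 4 * lipEnergy L v ≤ formSum (weightedLap σ) (upsMat β ^ 2) v v
        linarith)
      (fun t ht v => hf.neg_grad_zero_le ht v)
  have hD : 0 ≤ initEnergy f L / M := div_nonneg hf.initEnergy_nonneg (Nat.cast_nonneg M)
  have hinf := hf.objectiveInf_le (xfilterIter σ β f Q 0)
  set ω₁ := formSum (weightedLap σ) (upsMat β ^ 2) (xfilterIter σ β f Q 0)
    (xfilterIter σ β f Q 0) with hω₁
  have hω : 0 ≤ ω₁ := formSum_upsMat_nonneg hp.beta_pos _
  have h1 := hsmall (xfilterIter σ β f Q 0)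
  rw [← hω₁] at h1
  have h2 := hf.lipEnergy_nonneg (xfilterIter σ β f Q 0)
  -- `h1` and `h2` give 11κ̃ω₁ ≤ ω₁/4, so κ̃ drops out of the bound, and `hfirst` gives ω₁ ≤
  -- (49/144) d₀ᵀL⁻¹d₀ / M.
  have h3 : (15 / 8 + 8 * kappaTilde σ β / 2) * ω₁ ≤ 5 * (initEnergy f L / M) := by
    norm_num at hfirst
    linarith
  have h4 : 5 / (M : ℝ) * initEnergy f L = 5 * (initEnergy f L / M) := by ring
  have h5 : 0 ≤ 1 / (32 * kappaTilde σ β) := by positivity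
  have h6 : 0 ≤ (15 / 8 + 8 * kappaTilde σ β / 2) * ω₁ := by positivity
  rw [h4, mul_comm]
  refine mul_le_mul (by linarith) ?_ (by positivity) (by linarith)
  rw [show 8 * (1 + 1 / 7 : ℝ) ^ 2 = 512 / 49 by norm_num]
  linarith

end Iterates

end XFilter

end DistOpt

end

theorem theorem5p1 {M S : ℕ} (hM : 2 ≤ M)
    (G : SimpleGraph (Fin M)) [DecidableRel G.Adj] (hG : G.Connected)
    (f : Fin M → DistOpt.Vec S → ℝ) (L : Fin M → ℝ) (hf : DistOpt.InProblemClass f L) :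
    (∀ (σ : DistOpt.Edge G → ℝ) (β : Fin M → ℝ), DistOpt.DGPDAParams L σ β →
      ∀ (x : ℕ → Fin M → DistOpt.Vec S) (mu : ℕ → DistOpt.Edge G → DistOpt.Vec S),
        DistOpt.IsDGPDARun σ β f x mu →
        ∀ (T : ℕ) (hT : 1 ≤ T),
          (Finset.Icc 1 T).inf' (Finset.nonempty_Icc.2 hT) (fun r => DistOpt.gap σ f (x r)) ≤
            (8 * (DistOpt.objective f (x 0) - DistOpt.objectiveInf f
                + 2 / (M : ℝ) * DistOpt.initEnergy f L))
              * (4 * ∑ e, σ e ^ 2 + ∑ i, β i ^ 2 + 4) / (T : ℝ)) ∧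
    (∀ (σ : DistOpt.Edge G → ℝ) (β : Fin M → ℝ), DistOpt.XFilterParams L σ β →
      ∀ Q : ℕ, DistOpt.innerSteps σ β ≤ (Q : ℝ) →
        ∀ (T : ℕ) (hT : 1 ≤ T),
          (Finset.Icc 1 T).inf' (Finset.nonempty_Icc.2 hT)
              (fun r => DistOpt.gap σ f (DistOpt.xfilterIter σ β f Q r)) ≤
            (DistOpt.objective f (DistOpt.xfilterIter σ β f Q 0) - DistOpt.objectiveInf f
                + 5 / (M : ℝ) * DistOpt.initEnergy f L)
              * (128 * (∑ i, β i ^ 2 + 3 + 1 / (32 * DistOpt.kappaTilde σ β))) / (T : ℝ)) :=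
  ⟨fun _ _ hp _ _ hr T hT => hr.inf_gap_le hp hf T hT,
    fun _ _ hp _ hQ T hT => DistOpt.xfilter_inf_gap_le hM hp hf hQ T hT⟩
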